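/- Let $d\ge 1$ and let $\mathcal D\subset\mathbb R^d$ be open. A symmetric kernel $G$ on an open set $U\subset\mathbb R^d$ is called positive definite on $U$ if for every continuous function $\rho:\mathbb R^d\to\mathbb R$ with compact support contained in $U$ the integral $\int_{U\times U}G(x,y)\rho(x)\rho(y)\,\mathrm dx\,\mathrm dy$ converges absolutely and is nonnegative. Let $K$ be a symmetric positive definite kernel on $\mathcal D$ of the form $$K(x,y)=L(x,y)+\log\frac1{|x-y|}\qquad (x,y\in\mathcal D,\ x\ne y),$$ where $L:\mathcal D^2\to\mathbb R$ is continuous and $L\in H^s_{\mathrm{loc}}(\mathcal D^2)$ for some $s>d$; that is, for every $\rho\in C_c^\infty(\mathcal D^2)$ the function $\rho L$, extended by zero, belongs to $$H^s(\mathbb R^{2d})=\Big\{\varphi\in L^2(\mathbb R^{2d})\ :\ \int_{\mathbb R^{2d}}(1+|\xi|^2)^s|\hat\varphi(\xi)|^2\,\mathrm d\xi<\infty\Big\}.$$ Let $\mathcal D'$ be a bounded open set with $\overline{\mathcal D'}\subset\mathcal D$, and let $\delta>0$. Then there exists a kernel $K^{(\delta)}$ on $\mathcal D'$ which has a star-scale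 invariant part, that is, $$K^{(\delta)}(x,y)=K_0(x,y)+\int_0^\infty\kappa(e^t|x-y|)\,\mathrm dt\qquad (x,y\in\mathcal D',\ x\neq y),$$ where $K_0$ is a bounded, Hölder continuous, symmetric positive definite kernel on $\mathcal D'$ and $\kappa:[0,\infty)\to\mathbb R$ satisfies: (i) $\kappa$ is Lipschitz continuous and nonnegative; (ii) $\kappa(0)=1$ and $\kappa(r)=0$ for $r\ge1$; (iii) $(x,y)\mapsto\kappa(|x-y|)$ is positive definite on $\mathbb R^d$; and such that the difference $K^{(\delta)}-K$, defined off the diagonal of $\mathcal D'\times\mathcal D'$, extends to a continuous function $\Delta^{(\delta)}$ on $\mathcal D'\times\mathcal D'$ with the following properties: (A) $|\Delta^{(\delta)}(x,y)|\le\delta$ for all $x,y\in\mathcal D'$; (B) $\Delta^{(\delta)}$ is a positive definite kernel on $\mathcal D'$. -/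

import Mathlib

open MeasureTheory

noncomputable section

namespace StarScale

/-- The Euclidean space `ℝ^d`. -/
abbrev Euc (d : ℕ) : Type := EuclideanSpace ℝ (Fin d)

/-- The Euclidean space `ℝ^d × ℝ^d = ℝ^{2d}`, with the Euclidean norm. -/
abbrev Euc₂ (d : ℕ) : Type := WithLp 2 (Euc d × Euc d)

section Sobolev

variable {V : Type*} [NormedAddCommGroup V] [InnerProductSpace ℝ V] [FiniteDimensional ℝ V]
  [MeasurableSpace V] [BorelSpace V]

/-- The function `φ` belongs to the Sobolev space `H^s(V)`, for an exponent `s ≥ 0`: it is square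
integrable and `(1 + |ξ|²)^{s/2} φ̂` is square integrable. -/
def MemSobolevSpace (s : ℝ) (φ : V → ℂ) : Prop :=
  ∃ h : MemLp φ 2 (volume : Measure V),
    TemperedDistribution.MemSobolev s 2
      (Lp.toTemperedDistribution (h.toLp φ) : TemperedDistribution V ℂ)

/-- The function `φ` belongs to the local Sobolev space `H^s_loc(U)` of the open set `U`: its
product with every smooth `ρ` whose compact support lies in `U` belongs to `H^s(V)`. Only the values
of `φ` on `U` matter. -/
def MemSobolevLoc (s : ℝ) (U : Set V) (φ : V → ℝ) : Prop :=
  ∀ ρ : V → ℝ, ContDiff ℝ (⊤ : ℕ∞) ρ → HasCompactSupport ρ → tsupport ρ ⊆ U →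
    MemSobolevSpace s (fun z => ((ρ z * φ z : ℝ) : ℂ))

end Sobolev

variable {d : ℕ}

/-- `K` is a positive definite (covariance) kernel on `D`: it is symmetric, and for every continuous
function `ρ` with compact support in `D` the integral of `K(x,y) ρ(x) ρ(y)` over `D × D` converges
absolutely and is nonnegative. -/
def IsPosDefKernel (D : Set (Euc d)) (K : Euc d → Euc d → ℝ) : Prop :=
  (∀ x ∈ D, ∀ y ∈ D, K x y = K y x) ∧
  ∀ ρ : Euc d → ℝ, Continuous ρ → HasCompactSupport ρ → tsupport ρ ⊆ D →
    IntegrableOn (fun p : Euc d × Euc d => K p.1 p.2 * ρ p.1 * ρ p.2) (D ×ˢ D) ∧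
    0 ≤ ∫ p in D ×ˢ D, K p.1 p.2 * ρ p.1 * ρ p.2

/-- The kernel `K` is bounded on `D × D`. -/
def IsBoundedKernel (D : Set (Euc d)) (K : Euc d → Euc d → ℝ) : Prop :=
  ∃ M : ℝ, ∀ x ∈ D, ∀ y ∈ D, |K x y| ≤ M

/-- The kernel `K` is Hölder continuous on `D × D`, with some exponent in `(0, 1]`. -/
def IsHolderKernel (D : Set (Euc d)) (K : Euc d → Euc d → ℝ) : Prop :=
  ∃ C α : NNReal, 0 < α ∧ α ≤ 1 ∧
    HolderOnWith C α (fun p : Euc d × Euc d => K p.1 p.2) (D ×ˢ D)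

/-- Admissible seed functions `κ` on `[0, ∞)` in dimension `d`; the values of `κ` at negative
arguments are irrelevant. -/
structure IsSeed (d : ℕ) (κ : ℝ → ℝ) : Prop where
  lipschitz : ∃ C : NNReal, LipschitzOnWith C κ (Set.Ici 0)
  nonneg : ∀ r, 0 ≤ r → 0 ≤ κ r
  zero : κ 0 = 1
  eq_zero : ∀ r, 1 ≤ r → κ r = 0
  posDef : IsPosDefKernel (d := d) Set.univ (fun x y => κ ‖x - y‖)

/-- `K` has a star-scale invariant part on `D`. As both sides are infinite on the diagonal, the
decomposition is an identity between real numbers off the diagonal. -/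
def HasStarScaleInvariantPart (D : Set (Euc d)) (K : Euc d → Euc d → ℝ) : Prop :=
  ∃ (K₀ : Euc d → Euc d → ℝ) (κ : ℝ → ℝ),
    IsBoundedKernel D K₀ ∧ IsHolderKernel D K₀ ∧ IsPosDefKernel D K₀ ∧ IsSeed d κ ∧
    ∀ x ∈ D, ∀ y ∈ D, x ≠ y →
      K x y = K₀ x y + ∫ t in Set.Ioi (0 : ℝ), κ (Real.exp t * ‖x - y‖)

end StarScale

end

namespace StarScale

open FourierTransform TemperedDistribution SchwartzMap
open scoped SchwartzMap

/-! ### Sobolev functions as inverse Fourier transforms of weighted `L²` densities. -/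

section SobolevRepresentation

variable {V : Type*} [NormedAddCommGroup V] [InnerProductSpace ℝ V] [FiniteDimensional ℝ V]
  [MeasurableSpace V] [BorelSpace V]

/-! The perturbation is `Δ = ε R`, where `R = besselKernel s` is the stationary kernel with spectral
density `(1 + |ξ|²)^{-s/2}`. Since `s > d` this density is integrable, so `R` is bounded, continuous
and positive definite, and a small `ε` gives `|Δ| ≤ δ`. What has to be shown is that `K + ε R` has a
star-scale invariant part.

Take a smooth seed `k = φ ⋆ φ` (`exists_seedKernel`). Its star-scale integral is `log (1/|x|) + H x`
with `H` smooth (`exists_contDiff_starScale_eq_log`), so near `D'` one has `K = M + ∫₀^∞ k(eᵗ(x -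
y)) dt`, where `M` is a cut-off of `L - H` and still lies in `H^s`. Splitting the integral at `T`,
the scales `t > T` are the star-scale integral of the dilated seed `κ(e^T r)`, and the candidate for
`K₀` is `M + S_T + ε R`, where `S_T` collects the scales `t ≤ T`. Regularity of `K₀` is clear from
its three summands; positivity is the real content (`exists_nonneg_form_truncStar`).

For a test function `f` put `u = f ⋆ θ` with a mollifier `θ`, and let `E(f)` be the quadratic form
of `R`, the squared norm of order `-s/2`. Three estimates are combined. (1) `M(f,f) ≥ M(u,u) - (ε/2)
E(f)`: as `M ∈ H^s`, its associated operator is Hilbert–Schmidt from order `-s/2` to order `s/2`,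
and mollification is a small perturbation in that norm (`abs_form_sub_form_mollified_le`). (2)
`S_T(f,f) ≥ S_T(u,u)`, because `|θ̂| ≤ 1` and the spectral density of `k` is nonnegative. (3) The
remaining scales contribute at most `‖tail_T‖₁ ‖u‖₂² ≤ C_θ ‖tail_T‖₁ E(f)` to `K(u,u)`, which is
below `(ε/2) E(f)` once `T` is large depending on `θ`. Together with `K(u,u) ≥ 0` these give
`K₀(f,f) ≥ 0`. -/

theorem integral_fourierInv_mul {f g : V → ℂ} (hf : Integrable f) (hg : Integrable g) :
    ∫ ξ, 𝓕⁻ f ξ * g ξ = ∫ x, f x * 𝓕⁻ g x := by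
  have h := VectorFourier.integral_fourierIntegral_smul_eq_flip (L := innerₗ V)
    Real.continuous_fourierChar (by simpa using continuous_inner) hf hg.comp_neg
  rw [← integral_neg_eq_self]
  have e1 : ∀ ξ, 𝓕⁻ f (-ξ) = 𝓕 f ξ := fun ξ => by rw [Real.fourierInv_eq_fourier_neg, neg_neg]
  have e2 : ∀ x, 𝓕⁻ g x = 𝓕 (fun v => g (-v)) x := fun x => by
    rw [Real.fourierInv_eq_fourier_comp_neg]
  simp only [e1, e2]
  simpa using! h

/-- The Sobolev condition gives `φ̂ = J u` with `u ∈ L²` and `J = (1 + |ξ|²)^{-s/2}`. The bound on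
the dimension puts `J` in `L²`, so `J u` is integrable by Cauchy–Schwarz. Fourier inversion is then
checked against test functions, and continuity upgrades the a.e. equality. -/
theorem MemSobolevSpace.exists_eq_fourierInv {s : ℝ} (hs : Module.finrank ℝ V < 2 * s) {φ : V → ℂ}
    (hφ : Continuous φ) (h : MemSobolevSpace s φ) :
    ∃ F : V → ℂ, AEStronglyMeasurable F volume ∧
      Integrable (fun ξ => ‖F ξ‖ ^ 2 * (1 + ‖ξ‖ ^ 2) ^ s) ∧ Integrable F ∧ 𝓕⁻ F = φ := by
  obtain ⟨h2, hS⟩ := h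
  obtain ⟨u, hu⟩ := memSobolev_iff_exists_smulLeftCLM_fourier.mp hS
  set T : 𝓢'(V, ℂ) := Lp.toTemperedDistribution (h2.toLp φ) with hT
  set J : V → ℝ := fun ξ => (1 + ‖ξ‖ ^ 2) ^ (-s / 2) with hJ
  have hJc : Continuous J := by
    have : J.HasTemperateGrowth := by fun_prop
    exact this.1.continuous
  have hJ2 : MemLp J 2 volume := by
    rw [memLp_two_iff_integrable_sq hJc.aestronglyMeasurable]
    refine (integrable_rpow_neg_one_add_norm_sq (E := V) (μ := volume) hs).congr ?_
    filter_upwards with x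
    rw [hJ]
    simp only
    rw [← Real.rpow_mul_natCast (by positivity)]
    congr 1
    push_cast
    ring
  have hu2 : MemLp u 2 volume := Lp.memLp u
  have hJt : (fun ξ => ((J ξ : ℝ) : ℂ)).HasTemperateGrowth := by
    simp only [hJ]
    fun_prop
  set F : V → ℂ := fun ξ => (J ξ : ℂ) * u ξ with hF
  have hFi : Integrable F := hJ2.ofReal.integrable_mul hu2
  have hFsq : Integrable (fun ξ => ‖F ξ‖ ^ 2 * (1 + ‖ξ‖ ^ 2) ^ s) := by
    have := (memLp_two_iff_integrable_sq_norm hu2.aestronglyMeasurable).mp hu2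
    refine this.congr ?_
    filter_upwards with ξ
    simp only [hF, norm_mul, Complex.norm_real, Real.norm_eq_abs, mul_pow, sq_abs, hJ]
    rw [← Real.rpow_mul_natCast (by positivity), mul_right_comm, ← Real.rpow_add (by positivity)]
    push_cast
    rw [show -s / 2 * 2 + s = 0 by ring, Real.rpow_zero, one_mul]
  refine ⟨F, hFi.aestronglyMeasurable, hFsq, hFi, ?_⟩
  have hFT : 𝓕 T = smulLeftCLM ℂ (fun ξ => ((J ξ : ℝ) : ℂ)) (u : 𝓢'(V, ℂ)) := by
    rw [← hu, TemperedDistribution.smulLeftCLM_smulLeftCLM_apply (by fun_prop) hJt]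
    have h1 : (fun x : V => (((1 + ‖x‖ ^ 2) ^ (s / 2) : ℝ) : ℂ)) * (fun ξ => ((J ξ : ℝ) : ℂ)) =
        fun _ => 1 := by
      ext x
      simp only [Pi.mul_apply, hJ]
      norm_cast
      rw [← Real.rpow_add (by positivity)]
      ring_nf
      simp
    rw [h1, TemperedDistribution.smulLeftCLM_const, one_smul]
  -- Both sides are `𝓕 T` evaluated at `𝓕⁻ g`, once by the definition of `𝓕 T` and once through the
  -- density `F`.
  have key : ∀ g : 𝓢(V, ℂ), ∫ x, g x * φ x = ∫ x, g x * 𝓕⁻ F x := by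
    intro g
    have h1 : (𝓕 T) (𝓕⁻ g) = ∫ x, g x * φ x := by
      rw [TemperedDistribution.fourier_apply, FourierTransform.fourier_fourierInv_eq, hT,
        Lp.toTemperedDistribution_apply]
      refine integral_congr_ae ?_
      filter_upwards [h2.coeFn_toLp] with x hx
      rw [hx, smul_eq_mul]
    rw [← h1, hFT, TemperedDistribution.smulLeftCLM_apply_apply, Lp.toTemperedDistribution_apply,
      ← integral_fourierInv_mul g.integrable hFi]
    refine integral_congr_ae ?_
    filter_upwards with x
    rw [SchwartzMap.smulLeftCLM_apply_apply hJt, hF, SchwartzMap.fourierInv_coe]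
    simp only [smul_eq_mul]
    ring
  have hFc : Continuous (𝓕⁻ F) := by
    rw [Real.fourierInv_eq_fourier_comp_neg]
    exact VectorFourier.fourierIntegral_continuous Real.continuous_fourierChar
      (by simpa using continuous_inner) hFi.comp_neg
  have hae : ∀ᵐ x, 𝓕⁻ F x - φ x = 0 := by
    refine ae_eq_zero_of_integral_contDiff_smul_eq_zero
      ((hFc.sub hφ).locallyIntegrable (μ := volume)) ?_
    intro g hg hgc
    have hgc' : HasCompactSupport (fun x => (g x : ℂ)) := hgc.comp_left Complex.ofReal_zero
    have hg' : ContDiff ℝ (⊤ : ℕ∞) (fun x => (g x : ℂ)) := Complex.ofRealCLM.contDiff.comp hg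
    have := key (hgc'.toSchwartzMap hg')
    change ∫ x, (g x : ℂ) * φ x = ∫ x, (g x : ℂ) * 𝓕⁻ F x at this
    simp only [smul_sub]
    have hi : ∀ w : V → ℂ, Continuous w → Integrable (fun x => (g x : ℂ) * w x) := fun w hw =>
      (hg'.continuous.mul hw).integrable_of_hasCompactSupport hgc'.mul_right
    simp only [Complex.real_smul]
    rw [integral_sub (hi _ hFc) (hi _ hφ), this, sub_self]
  have := (Continuous.ae_eq_iff_eq volume hFc hφ).mp (by
    filter_upwards [hae] with x hx using sub_eq_zero.mp hx)
  exact this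

theorem MemSobolevSpace.add {s : ℝ} {φ ψ : V → ℂ} (hφ : MemSobolevSpace s φ)
    (hψ : MemSobolevSpace s ψ) : MemSobolevSpace s (fun x => φ x + ψ x) := by
  obtain ⟨h1, h1'⟩ := hφ
  obtain ⟨h2, h2'⟩ := hψ
  refine ⟨h1.add h2, ?_⟩
  convert! h1'.add h2' using 1
  simp only [← Lp.toTemperedDistributionCLM_apply, ← map_add]
  rfl

theorem memSobolevSpace_of_contDiff (s : ℝ) {φ : V → ℂ} (hφ : ContDiff ℝ (⊤ : ℕ∞) φ)
    (hc : HasCompactSupport φ) : MemSobolevSpace s φ := by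
  let f : 𝓢(V, ℂ) := hc.toSchwartzMap hφ
  refine ⟨(f.memLp 2 : MemLp (⇑f) 2 volume), ?_⟩
  have := SchwartzMap.memSobolev (s := s) (p := 2) f
  rwa [← Lp.toTemperedDistribution_toLp_eq (p := 2)] at this

end SobolevRepresentation

end StarScale

namespace StarScale

open FourierTransform Set Filter Topology
open scoped Convolution ContDiff

/-! ### Smooth dependence on parameters and Hadamard's lemma. -/

section ParametricIntegral

/-- The integral is a convolution in `τ`, evaluated at `0`, of the indicator of `[0, 1]` with a
reflected copy of `h`. The bump equals `1` on `[-1, 1]`, so it supplies compact support without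
altering the value. -/
theorem contDiff_integral_param {E F : Type*} [NormedAddCommGroup E] [NormedSpace ℝ E]
    [NormedAddCommGroup F] [NormedSpace ℝ F] {h : E × ℝ → F} (hh : ContDiff ℝ ∞ h) :
    ContDiff ℝ ∞ (fun x => ∫ τ in (0 : ℝ)..1, h (x, τ)) := by
  let χ : ContDiffBump (0 : ℝ) := ⟨1, 2, one_pos, one_lt_two⟩
  let f : ℝ → ℝ := (Icc (0 : ℝ) 1).indicator 1
  let g : E → ℝ → F := fun p t => χ (-t) • h (p, -t)
  have hg : ContDiff ℝ ∞ ↿g := by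
    change ContDiff ℝ ∞ (fun q : E × ℝ => χ (-q.2) • h (q.1, -q.2))
    have h1 : ContDiff ℝ ∞ (fun q : E × ℝ => χ (-q.2)) := χ.contDiff.comp contDiff_snd.neg
    have h2 : ContDiff ℝ ∞ (fun q : E × ℝ => h (q.1, -q.2)) :=
      hh.comp (contDiff_fst.prodMk contDiff_snd.neg)
    exact h1.smul h2
  have hf : LocallyIntegrable f volume :=
    ((integrable_indicator_iff measurableSet_Icc).mpr
      (integrableOn_const (by simp))).locallyIntegrable
  have hsupp : ∀ p : E, ∀ t, p ∈ univ → t ∉ Metric.closedBall (0 : ℝ) 2 → g p t = 0 := by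
    intro p t _ ht
    have : χ (-t) = 0 := by
      refine χ.zero_of_le_dist ?_
      simpa [Real.dist_eq, χ] using (not_le.mp (by simpa using ht) : (2 : ℝ) < |t|).le
    simp [g, this]
  have key := contDiffOn_convolution_right_with_param_comp (n := ⊤) (μ := volume)
    (ContinuousLinearMap.lsmul ℝ ℝ) (v := fun _ : E => (0 : ℝ)) contDiffOn_const isOpen_univ
    (isCompact_closedBall 0 2) hsupp hf hg.contDiffOn
  rw [contDiffOn_univ] at key
  convert key using 2 with x
  rw [convolution_def, intervalIntegral.integral_of_le zero_le_one, ← integral_Icc_eq_integral_Ioc,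
    ← integral_indicator measurableSet_Icc]
  congr 1 with t
  by_cases ht : t ∈ Icc (0 : ℝ) 1
  · have : χ t = 1 := by
      refine χ.one_of_mem_closedBall ?_
      simpa [Real.dist_eq, χ, abs_of_nonneg ht.1] using ht.2
    simp [f, g, ht, this]
  · simp [f, ht]

/-- Hadamard's lemma. -/
theorem exists_contDiff_eq_add_apply {E : Type*} [NormedAddCommGroup E] [NormedSpace ℝ E]
    {k : E → ℝ} (hk : ContDiff ℝ ∞ k) :
    ∃ b : E → E →L[ℝ] ℝ, ContDiff ℝ ∞ b ∧ ∀ y, k y = k 0 + b y y := by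
  have hD : ContDiff ℝ ∞ (fderiv ℝ k) := hk.fderiv_right (by simp)
  have hc : ContDiff ℝ ∞ (fun p : E × ℝ => fderiv ℝ k (p.2 • p.1)) :=
    hD.comp (contDiff_snd.smul contDiff_fst)
  refine ⟨fun y => ∫ σ in (0 : ℝ)..1, fderiv ℝ k (σ • y), contDiff_integral_param hc, fun y => ?_⟩
  have hcy : Continuous (fun σ : ℝ => fderiv ℝ k (σ • y)) :=
    hc.continuous.comp (Continuous.prodMk continuous_const continuous_id)
  have hd : ∀ σ : ℝ, HasDerivAt (fun σ : ℝ => k (σ • y)) (fderiv ℝ k (σ • y) y) σ := fun σ => by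
    have h1 : HasDerivAt (fun σ : ℝ => σ • y) y σ := by
      simpa using (hasDerivAt_id σ).smul_const y
    exact ((hk.differentiable (by simp)) (σ • y)).hasFDerivAt.comp_hasDerivAt σ h1
  have := intervalIntegral.integral_eq_sub_of_hasDerivAt (a := 0) (b := 1) (fun σ _ => hd σ)
    ((hcy.clm_apply continuous_const).intervalIntegrable 0 1)
  rw [← ContinuousLinearMap.intervalIntegral_apply (hcy.intervalIntegrable 0 1), ] at this
  rw [this]
  simp

end ParametricIntegral

/-! ### The logarithm as a star-scale integral. -/

section SeedKernel

variable {V : Type*} [NormedAddCommGroup V] [InnerProductSpace ℝ V]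

/-- The logarithmic singularity is the star-scale integral of a seed up to a smooth function. -/
theorem exists_contDiff_starScale_eq_log {k : V → ℝ} {κ : ℝ → ℝ} (hk : ContDiff ℝ ∞ k)
    (hκ : ContDiff ℝ ∞ κ) (hkκ : ∀ x, k x = κ ‖x‖) (h0 : κ 0 = 1) (h1 : ∀ r, 1 ≤ r → κ r = 0) :
    ∃ H : V → ℝ, ContDiff ℝ ∞ H ∧ ∀ x, x ≠ 0 →
      ∫ t in Ioi (0 : ℝ), κ (Real.exp t * ‖x‖) = Real.log (1 / ‖x‖) + H x := by
  obtain ⟨b, hb, hkb⟩ := exists_contDiff_eq_add_apply hk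
  obtain ⟨c, hc, hκc⟩ := exists_contDiff_eq_add_apply hκ
  have hk0 : k 0 = 1 := by rw [hkκ, norm_zero, h0]
  set q : ℝ → ℝ := fun u => - c u 1 with hq
  have hqc : Continuous q := (hc.continuous.clm_apply continuous_const).neg
  have hκq : ∀ u, κ u = 1 - u * q u := fun u => by
    have : c u u = u * c u 1 := by
      conv_lhs => rw [show u = u • (1 : ℝ) by simp]
      rw [map_smul]
      simp
    rw [hκc, h0, this, hq]
    ring
  -- With `κ(u) = 1 - u q(u)`, the star integral is `∫_r^1 κ(u)/u du = log (1/r) - ∫₀¹ q + ∫₀^r q`.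
  -- The last term is not visibly smooth at `x = 0` as a function of `r = |x|`; comparing the
  -- Hadamard expansions of `k` and `κ` rewrites it through `b`, where smoothness in `x` is evident.
  refine ⟨fun x => -(∫ u in (0 : ℝ)..1, q u) - ∫ τ in (0 : ℝ)..1, b (τ • x) x, ?_, ?_⟩
  · refine contDiff_const.sub (contDiff_integral_param (h := fun p : V × ℝ => b (p.2 • p.1) p.1) ?_)
    exact (hb.comp (contDiff_snd.smul contDiff_fst)).clm_apply contDiff_fst
  intro x hx
  set r := ‖x‖ with hr
  have hr0 : 0 < r := norm_pos_iff.mpr hx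
  have hH : ∫ τ in (0 : ℝ)..1, b (τ • x) x = - ∫ u in (0 : ℝ)..r, q u := by
    have e1 : ∫ u in (0 : ℝ)..r, q u = ∫ τ in (0 : ℝ)..1, r * q (τ * r) := by
      rw [intervalIntegral.integral_const_mul, intervalIntegral.mul_integral_comp_mul_right]
      simp
    rw [e1, ← intervalIntegral.integral_neg]
    refine intervalIntegral.integral_congr_ae ?_
    filter_upwards with τ hτ
    rw [uIoc_of_le zero_le_one] at hτ
    have e2 := hkb (τ • x)
    rw [hkκ, norm_smul, Real.norm_of_nonneg hτ.1.le, hκq, hk0, map_smul, smul_eq_mul] at e2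
    have := hτ.1.ne'
    apply mul_left_cancel₀ this
    linarith
  -- Beyond this time the integrand vanishes; the maximum with `0` covers `r > 1`.
  set T := max 0 (Real.log (1 / r)) with hT
  have hTr : 1 ≤ Real.exp T * r := by
    have : Real.log (1 / r) ≤ T := le_max_right _ _
    have := Real.exp_le_exp.mpr this
    rw [Real.exp_log (by positivity)] at this
    calc 1 = 1 / r * r := by field_simp
      _ ≤ _ := by gcongr
  have hT0 : 0 ≤ T := le_max_left _ _
  have e1 : ∫ t in Ioi (0 : ℝ), κ (Real.exp t * r) = ∫ t in (0 : ℝ)..T, κ (Real.exp t * r) := by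
    rw [intervalIntegral.integral_of_le hT0]
    refine setIntegral_eq_of_subset_of_forall_sdiff_eq_zero measurableSet_Ioi Ioc_subset_Ioi_self ?_
    intro t ht
    apply h1
    have : T < t := by
      by_contra hcon
      exact ht.2 ⟨ht.1, not_lt.mp hcon⟩
    exact hTr.trans (by gcongr)
  have hinv : ∀ a b : ℝ, 0 < a → 0 < b → ContinuousOn (fun u : ℝ => κ u / u) (uIcc a b) := by
    intro a b ha hb
    refine hκ.continuous.continuousOn.div continuousOn_id ?_
    intro u hu
    exact ((lt_min ha hb).trans_le hu.1).ne'
  have e2 : ∫ t in (0 : ℝ)..T, κ (Real.exp t * r) = ∫ u in r..(Real.exp T * r), κ u / u := by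
    have := intervalIntegral.integral_comp_mul_deriv'' (a := 0) (b := T)
      (f := fun t => Real.exp t * r) (f' := fun t => Real.exp t * r) (g := fun u => κ u / u)
      (by fun_prop) (fun t _ => ((Real.hasDerivAt_exp t).mul_const r).hasDerivWithinAt)
      (by fun_prop) (by
        refine hκ.continuous.continuousOn.div continuousOn_id ?_
        rintro u ⟨t, _, rfl⟩
        positivity)
    simp only [Real.exp_zero, one_mul] at this
    rw [← this]
    refine intervalIntegral.integral_congr fun t _ => ?_
    simp only [Function.comp]
    field_simp
  have e3 : ∫ u in r..(Real.exp T * r), κ u / u = ∫ u in r..1, κ u / u := by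
    rw [← intervalIntegral.integral_add_adjacent_intervals
      (hinv r 1 hr0 one_pos).intervalIntegrable
      (hinv 1 _ one_pos (by positivity)).intervalIntegrable]
    rw [intervalIntegral.integral_congr (g := fun _ => (0 : ℝ)) (a := 1)]
    · simp
    · intro u hu
      rw [uIcc_of_le hTr] at hu
      simp [h1 u hu.1]
  have e4 : ∫ u in r..1, κ u / u = ∫ u in r..1, (u⁻¹ - q u) := by
    refine intervalIntegral.integral_congr fun u hu => ?_
    have : 0 < u := (lt_min hr0 one_pos).trans_le hu.1
    simp only [hκq]
    field_simp
  beta_reduce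
  rw [e1, e2, e3, e4, intervalIntegral.integral_sub _ (hqc.intervalIntegrable _ _),
    integral_inv_of_pos hr0 one_pos, hH,
    ← intervalIntegral.integral_interval_sub_left (hqc.intervalIntegrable 0 1)
      (hqc.intervalIntegrable 0 r)]
  · ring
  · refine intervalIntegral.intervalIntegrable_inv (fun u hu => ?_) continuousOn_id
    exact ((lt_min hr0 one_pos).trans_le hu.1).ne'

end SeedKernel

end StarScale

namespace StarScale

open FourierTransform Set Filter Topology
open scoped Convolution ContDiff

/-! ### Construction of a smooth seed with nonnegative spectral density. -/

section SeedExistence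

variable {V : Type*} [NormedAddCommGroup V] [InnerProductSpace ℝ V] [FiniteDimensional ℝ V]
  [MeasurableSpace V] [BorelSpace V]

theorem im_fourier_ofReal_eq_zero {φ : V → ℝ} (hφ : ∀ x, φ (-x) = φ x) (ξ : V) :
    (𝓕 (fun x => (φ x : ℂ)) ξ).im = 0 := by
  have h : starRingEnd ℂ (𝓕 (fun x => (φ x : ℂ)) ξ) = 𝓕 (fun x => (φ x : ℂ)) ξ := by
    rw [Real.fourier_eq', ← integral_conj, ← integral_neg_eq_self]
    refine integral_congr_ae (.of_forall fun x => ?_)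
    simp only [smul_eq_mul, map_mul, Complex.conj_ofReal, ← Complex.exp_conj, Complex.conj_I, hφ,
      inner_neg_left]
    congr 2
    push_cast
    ring
  exact Complex.conj_eq_iff_im.mp h

theorem re_fourierInv_eq {g : V → ℂ} (hg : ∀ ξ, (g ξ).im = 0) (hi : Integrable g) (x : V) :
    (𝓕⁻ g x).re = ∫ ξ, (g ξ).re * Real.cos (2 * Real.pi * inner ℝ ξ x) := by
  rw [Real.fourierInv_eq']
  refine (integral_re (𝕜 := ℂ) ?_).symm.trans ?_
  · refine hi.bdd_mul (c := 1) (by fun_prop) (.of_forall fun ξ => ?_)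
    rw [Complex.norm_exp_ofReal_mul_I]
  · refine integral_congr_ae (.of_forall fun ξ => ?_)
    change (Complex.exp _ * g ξ).re = _
    rw [Complex.mul_re, hg, Complex.exp_ofReal_mul_I_re]
    ring

variable (V) in
-- The form is dictated by the autoconvolution `φ ⋆ φ`: radius `1/2` puts its support in the unit
-- ball, evenness and the `L²` normalization give the value `1` at the origin, and radial symmetry
-- is inherited.
theorem exists_radial_bump [Nontrivial V] : ∃ φ : V → ℝ, ContDiff ℝ ∞ φ ∧ HasCompactSupport φ ∧
    (∀ x, 0 ≤ φ x) ∧ (∀ x, 1 / 2 ≤ ‖x‖ → φ x = 0) ∧ (∀ x y, ‖x‖ = ‖y‖ → φ x = φ y) ∧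
    ∫ x, φ x * φ x = 1 := by
  let ψ : V → ℝ := fun x => Real.smoothTransition (1 - 4 * ‖x‖ ^ 2)
  have hψ : ContDiff ℝ ∞ ψ := Real.smoothTransition.contDiff.comp
    (contDiff_const.sub (contDiff_const.mul (contDiff_id.norm_sq ℝ)))
  have h0 : ∀ x, 1 / 2 ≤ ‖x‖ → ψ x = 0 := fun x hx =>
    Real.smoothTransition.zero_of_nonpos (by nlinarith)
  have hc : HasCompactSupport ψ := by
    refine HasCompactSupport.of_support_subset_isCompact (isCompact_closedBall (0 : V) (1 / 2)) ?_
    intro x hx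
    by_contra hcon
    rw [mem_closedBall_zero_iff, not_le] at hcon
    exact hx (h0 x hcon.le)
  have hpos : 0 < ∫ x, ψ x * ψ x := by
    refine (hψ.continuous.mul hψ.continuous).integral_pos_of_hasCompactSupport_nonneg_nonzero
      (x := 0) hc.mul_right (fun x => mul_self_nonneg _) ?_
    have : ψ 0 = 1 := by simp [ψ]
    simp [this]
  set I := ∫ x, ψ x * ψ x
  refine ⟨fun x => (√I)⁻¹ * ψ x, contDiff_const.mul hψ, hc.mul_left,
    fun x => mul_nonneg (by positivity) (Real.smoothTransition.nonneg _), fun x hx => by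
      simp [h0 x hx], fun x y hxy => by simp [ψ, hxy], ?_⟩
  have : ∀ x, (√I)⁻¹ * ψ x * ((√I)⁻¹ * ψ x) = I⁻¹ * (ψ x * ψ x) := fun x => by
    have : (√I)⁻¹ * (√I)⁻¹ = I⁻¹ := by rw [← mul_inv, Real.mul_self_sqrt hpos.le]
    rw [← this]; ring
  simp_rw [this]
  rw [integral_const_mul, inv_mul_cancel₀ hpos.ne']

variable (V) in
/-- There is a smooth seed function, with an explicit spectral representation. -/
theorem exists_seedKernel [Nontrivial V] : ∃ (k : V → ℝ) (κ : ℝ → ℝ) (a : V → ℝ),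
    ContDiff ℝ ∞ k ∧ HasCompactSupport k ∧ ContDiff ℝ ∞ κ ∧ (∃ C, LipschitzWith C κ) ∧
    (∀ x, k x = κ ‖x‖) ∧ (∀ r, 0 ≤ κ r) ∧ κ 0 = 1 ∧ (∀ r, 1 ≤ r → κ r = 0) ∧
    Integrable a ∧ (∀ ξ, 0 ≤ a ξ) ∧
    ∀ x, k x = ∫ ξ, a ξ * Real.cos (2 * Real.pi * inner ℝ ξ x) := by
  obtain ⟨φ, hφ, hφc, hφ0, hφs, hφr, hφ1⟩ := exists_radial_bump V
  obtain ⟨e, he⟩ := exists_norm_eq V zero_le_one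
  have hφi : Integrable φ := hφ.continuous.integrable_of_hasCompactSupport hφc
  let k : V → ℝ := φ ⋆[ContinuousLinearMap.mul ℝ ℝ] φ
  have hkdef : ∀ x, k x = ∫ y, φ y * φ (x - y) := fun x => rfl
  have hk : ContDiff ℝ ∞ k := hφc.contDiff_convolution_right (n := ⊤) _
    hφ.continuous.locallyIntegrable hφ
  have hkc : HasCompactSupport k := hφc.convolution _ hφc
  have hkr : ∀ x y, ‖x‖ = ‖y‖ → k x = k y := by
    intro x y hxy
    -- For `|x| = |y|` this reflection carries `x` to `y`; it preserves Lebesgue measure and the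
    -- radial `φ`.
    let A := (Submodule.span ℝ {x - y})ᗮ.reflection
    have hA : A x = y := Submodule.reflection_sub hxy
    rw [hkdef y, ← A.measurePreserving.integral_comp A.toHomeomorph.measurableEmbedding, hkdef]
    refine integral_congr_ae (.of_forall fun z => ?_)
    beta_reduce
    rw [← hA, ← map_sub, hφr (A z) z (A.norm_map z), hφr (A (x - z)) (x - z) (A.norm_map _)]
  -- Restricting `k` to a line makes the profile smooth on all of `ℝ`, including at `0`.
  let κ : ℝ → ℝ := fun r => k (r • e)
  have hκ : ContDiff ℝ ∞ κ := hk.comp (contDiff_id.smul contDiff_const)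
  have hk0 : ∀ x, 1 ≤ ‖x‖ → k x = 0 := by
    intro x hx
    rw [hkdef]
    rw [integral_congr_ae (g := fun _ => (0 : ℝ))]
    · simp
    refine .of_forall fun y => ?_
    by_cases hy : 1 / 2 ≤ ‖y‖
    · simp [hφs y hy]
    · have : 1 / 2 ≤ ‖x - y‖ := by
        have := norm_sub_norm_le x y
        linarith
      simp [hφs _ this]
  have hke : ∀ x, k x = κ ‖x‖ := fun x => hkr _ _ (by simp [norm_smul, he])
  have hkn : ∀ x, 0 ≤ k x := fun x => integral_nonneg fun y => mul_nonneg (hφ0 _) (hφ0 _)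
  have hκ1 : κ 0 = 1 := by
    simp only [κ, zero_smul, hkdef, zero_sub, ← hφ1]
    refine integral_congr_ae (.of_forall fun y => ?_)
    beta_reduce
    rw [hφr (-y) y (norm_neg y)]
  have hκ0 : ∀ r, 1 ≤ r → κ r = 0 := fun r hr => hk0 _ (by
    rw [norm_smul, he, mul_one]; exact hr.trans (le_abs_self r))
  have hlip : ∃ C, LipschitzWith C κ := by
    refine ContDiff.lipschitzWith_of_hasCompactSupport (𝕂 := ℝ) (n := ∞) ?_ hκ (by simp)
    refine HasCompactSupport.of_support_subset_isCompact (isCompact_closedBall (0 : ℝ) 1) ?_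
    intro r hr
    by_contra hcon
    rw [mem_closedBall_zero_iff, not_le, Real.norm_eq_abs] at hcon
    exact hr (hk0 _ (by rw [norm_smul, he, mul_one]; exact hcon.le))
  set Φ : V → ℂ := 𝓕 (fun x => (φ x : ℂ)) with hΦ
  -- `Φ` is real because `φ` is even, so the spectral density `Φ²` is nonnegative.
  have hkF : 𝓕 (fun x => (k x : ℂ)) = fun ξ => Φ ξ * Φ ξ := by
    ext ξ
    have hφC : Integrable (fun x => (φ x : ℂ)) := hφi.ofReal
    rw [hΦ, ← Real.fourier_mul_convolution_eq hφC hφC]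
    refine congrArg (fun g : V → ℂ => 𝓕 g ξ) (funext fun x => ?_)
    rw [hkdef, convolution_def]
    refine (integral_ofReal (𝕜 := ℂ)).symm.trans ?_
    simp
  have hΦim : ∀ ξ, (Φ ξ).im = 0 := im_fourier_ofReal_eq_zero fun x => hφr _ _ (norm_neg x)
  have hkcC : HasCompactSupport (fun x => (k x : ℂ)) := hkc.comp_left Complex.ofReal_zero
  have hkC : ContDiff ℝ ∞ (fun x => (k x : ℂ)) := Complex.ofRealCLM.contDiff.comp hk
  have hkFi : Integrable (𝓕 (fun x => (k x : ℂ))) := by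
    have := (𝓕 (hkcC.toSchwartzMap hkC)).integrable (μ := volume)
    rwa [SchwartzMap.fourier_coe] at this
  refine ⟨k, κ, fun ξ => (𝓕 (fun x => (k x : ℂ)) ξ).re, hk, hkc, hκ, hlip, hke,
    fun r => hkn _, hκ1, hκ0, hkFi.re, fun ξ => ?_, fun x => ?_⟩
  · rw [hkF]
    simp only [Complex.mul_re, hΦim, mul_zero, sub_zero]
    exact mul_self_nonneg _
  · rw [← re_fourierInv_eq _ hkFi, hkC.continuous.fourierInv_fourier_eq
      (hkC.continuous.integrable_of_hasCompactSupport hkcC) hkFi, Complex.ofReal_re]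
    intro ξ
    rw [hkF]
    simp [hΦim]

end SeedExistence

end StarScale

namespace StarScale

open FourierTransform Set Filter Topology
open scoped ContDiff

/-! ### Splitting star-scale integrals by scale. -/

section StarIntegrals

variable {V : Type*} [NormedAddCommGroup V] [NormedSpace ℝ V]

/-- The part of a star-scale integral coming from the scales in `(e^{-T}, 1]`. -/
noncomputable def truncStar (k : V → ℝ) (T : ℝ) (x : V) : ℝ := ∫ t in Ioc 0 T, k (Real.exp t • x)

/-- The part of a star-scale integral coming from the scales below `e^{-T}`. -/
noncomputable def tailStar (k : V → ℝ) (T : ℝ) (x : V) : ℝ := ∫ t in Ioi T, k (Real.exp t • x)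

/-- Translate `t` by `T`. The tail is thus a dilate of the full integral, which yields both its `L¹`
decay in `T` and the dilated seed of the final decomposition. -/
theorem tailStar_eq_comp_smul (k : V → ℝ) (T : ℝ) (x : V) :
    tailStar k T x = tailStar k 0 (Real.exp T • x) := by
  rw [tailStar, tailStar]
  have := (measurePreserving_add_right volume T).setIntegral_preimage_emb
    (measurableEmbedding_addRight T) (fun t => k (Real.exp t • x)) (Ioi T)
  rw [← this]
  simp only [preimage_add_const_Ioi, sub_self, Real.exp_add, smul_smul]

end StarIntegrals

/-! ### Quadratic forms of stationary kernels. -/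

section Forms

variable {V : Type*} [NormedAddCommGroup V] [InnerProductSpace ℝ V] [FiniteDimensional ℝ V]
  [MeasurableSpace V] [BorelSpace V]

/-- The Fourier transform of a real-valued function. -/
noncomputable def fourierReal (f : V → ℝ) : V → ℂ := 𝓕 (fun x => (f x : ℂ))

theorem continuous_fourierReal {f : V → ℝ} (hf : Integrable f) : Continuous (fourierReal f) :=
  VectorFourier.fourierIntegral_continuous Real.continuous_fourierChar
    (by simpa using continuous_inner) hf.ofReal

theorem norm_fourierReal_le {f : V → ℝ} (ξ : V) : ‖fourierReal f ξ‖ ≤ ∫ x, |f x| := by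
  have := VectorFourier.norm_fourierIntegral_le_integral_norm Real.fourierChar volume (innerₗ V)
    (fun x => (f x : ℂ)) ξ
  simpa using! this

theorem norm_fourierReal_sq {f : V → ℝ} (hf : Integrable f) (ξ : V) :
    ‖fourierReal f ξ‖ ^ 2 =
      ∫ p : V × V, Real.cos (2 * Real.pi * inner ℝ ξ (p.1 - p.2)) * f p.1 * f p.2 := by
  have hC : Integrable (fun x => (f x : ℂ)) := hf.ofReal
  have e1 : fourierReal f ξ = ∫ x, Complex.exp (↑(-2 * Real.pi * inner ℝ x ξ) * Complex.I) * f x := by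
    rw [fourierReal, Real.fourier_eq']
    rfl
  have e2 : starRingEnd ℂ (fourierReal f ξ) =
      ∫ x, Complex.exp (↑(2 * Real.pi * inner ℝ x ξ) * Complex.I) * f x := by
    rw [e1, ← integral_conj]
    refine integral_congr_ae (.of_forall fun x => ?_)
    simp only [map_mul, Complex.conj_ofReal, ← Complex.exp_conj, Complex.conj_I]
    congr 2
    push_cast
    ring
  have e3 : ((‖fourierReal f ξ‖ ^ 2 : ℝ) : ℂ) = ∫ p : V × V,
      Complex.exp (↑(-2 * Real.pi * inner ℝ ξ (p.1 - p.2)) * Complex.I) * (f p.1 * f p.2) := by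
    push_cast
    rw [← Complex.mul_conj', e2, e1, ← integral_prod_mul]
    refine integral_congr_ae (.of_forall fun p => ?_)
    beta_reduce
    rw [mul_mul_mul_comm, ← Complex.exp_add]
    congr 2
    rw [real_inner_comm ξ, real_inner_comm ξ, inner_sub_right]
    push_cast
    ring
  have hi : Integrable (fun p : V × V =>
      Complex.exp (↑(-2 * Real.pi * inner ℝ ξ (p.1 - p.2)) * Complex.I) * (f p.1 * f p.2)) := by
    refine (hC.mul_prod hC).bdd_mul (c := 1) (by fun_prop) (.of_forall fun p => ?_)
    rw [Complex.norm_exp_ofReal_mul_I]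
  have e4 := congrArg Complex.re e3
  rw [Complex.ofReal_re] at e4
  rw [e4]
  refine (integral_re (𝕜 := ℂ) hi).symm.trans (integral_congr_ae (.of_forall fun p => ?_))
  change (Complex.exp _ * ((f p.1 : ℂ) * f p.2)).re = _
  rw [← Complex.ofReal_mul, Complex.re_mul_ofReal, Complex.exp_ofReal_mul_I_re, neg_mul, neg_mul,
    Real.cos_neg]
  ring

/-- The quadratic form of a stationary kernel with integrable spectral density. -/
theorem integral_spectral_form {a f : V → ℝ} (ha : Integrable a) (hf : Integrable f) (l : ℝ) :
    ∫ p : V × V, (∫ ξ, a ξ * Real.cos (2 * Real.pi * inner ℝ ξ (l • (p.1 - p.2)))) * f p.1 * f p.2 =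
      ∫ ξ, a ξ * ‖fourierReal f (l • ξ)‖ ^ 2 := by
  have h1 : ∀ ξ, a ξ * ‖fourierReal f (l • ξ)‖ ^ 2 =
      ∫ p : V × V, a ξ * (Real.cos (2 * Real.pi * inner ℝ ξ (l • (p.1 - p.2))) * f p.1 * f p.2) := by
    intro ξ
    rw [norm_fourierReal_sq hf, integral_const_mul]
    simp only [inner_smul_left, inner_smul_right, conj_trivial]
  simp_rw [h1]
  rw [integral_integral_swap]
  · refine integral_congr_ae (.of_forall fun p => ?_)
    beta_reduce
    rw [mul_assoc, ← integral_mul_const]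
    congr 1 with ξ
    ring
  · have hff : Integrable (fun p : V × V => f p.1 * f p.2) := hf.mul_prod hf
    have h2 := (ha.mul_prod hff).bdd_mul (c := 1)
      (f := fun z : V × V × V => Real.cos (2 * Real.pi * inner ℝ z.1 (l • (z.2.1 - z.2.2))))
      (by fun_prop) (.of_forall fun z => Real.abs_cos_le_one _)
    refine h2.congr (.of_forall fun z => ?_)
    simp only [Function.uncurry]
    ring

/-- Fubini in `t`: `k` is bounded by `‖a‖₁` and the range of scales is finite. Each scale
contributes the spectral form of a dilate of `k`. -/
theorem integral_truncStar_form {a k f : V → ℝ} (ha : Integrable a) (hk : Continuous k)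
    (hka : ∀ x, k x = ∫ ξ, a ξ * Real.cos (2 * Real.pi * inner ℝ ξ x)) (hf : Integrable f) (T : ℝ) :
    Integrable (fun t => ∫ ξ, a ξ * ‖fourierReal f (Real.exp t • ξ)‖ ^ 2)
      (volume.restrict (Ioc 0 T)) ∧
    Integrable (fun p : V × V => truncStar k T (p.1 - p.2) * f p.1 * f p.2) ∧
    ∫ p : V × V, truncStar k T (p.1 - p.2) * f p.1 * f p.2 =
      ∫ t in Ioc 0 T, ∫ ξ, a ξ * ‖fourierReal f (Real.exp t • ξ)‖ ^ 2 := by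
  have hb : ∀ x, |k x| ≤ ∫ ξ, |a ξ| := fun x => by
    rw [hka]
    refine (abs_integral_le_integral_abs).trans (integral_mono_of_nonneg
      (.of_forall fun _ => abs_nonneg _) ha.abs (.of_forall fun ξ => ?_))
    beta_reduce
    rw [abs_mul]
    exact mul_le_of_le_one_right (abs_nonneg _) (Real.abs_cos_le_one _)
  have hff : Integrable (fun p : V × V => f p.1 * f p.2) := hf.mul_prod hf
  have hi : Integrable (fun z : (V × V) × ℝ => k (Real.exp z.2 • (z.1.1 - z.1.2)) * f z.1.1 * f z.1.2)
      ((volume : Measure (V × V)).prod (volume.restrict (Ioc 0 T))) := by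
    have := (hff.mul_prod (integrable_const (1 : ℝ) (μ := volume.restrict (Ioc (0 : ℝ) T)))).bdd_mul
      (c := ∫ ξ, |a ξ|) (f := fun z : (V × V) × ℝ => k (Real.exp z.2 • (z.1.1 - z.1.2)))
      (by fun_prop) (.of_forall fun z => hb _)
    refine this.congr (.of_forall fun z => ?_)
    simp only
    ring
  have hform : ∀ t : ℝ, ∫ p : V × V, k (Real.exp t • (p.1 - p.2)) * f p.1 * f p.2 =
      ∫ ξ, a ξ * ‖fourierReal f (Real.exp t • ξ)‖ ^ 2 := fun t => by
    simp_rw [hka]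
    exact integral_spectral_form ha hf _
  have hin : ∀ p : V × V, ∫ t in Ioc 0 T, k (Real.exp t • (p.1 - p.2)) * f p.1 * f p.2 =
      truncStar k T (p.1 - p.2) * f p.1 * f p.2 := fun p => by
    rw [truncStar, integral_mul_const, integral_mul_const]
  refine ⟨?_, ?_, ?_⟩
  · simp_rw [← hform]
    exact hi.integral_prod_right
  · simp_rw [← hin]
    exact hi.integral_prod_left
  · simp_rw [← hform, ← hin]
    exact integral_integral_swap hi

/-- Every scale has a nonnegative spectral density, so the form only sees, and increases with, the
modulus of the Fourier transform. It is applied with the mollified function on the smaller side. -/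
theorem integral_truncStar_form_mono {a k f g : V → ℝ} (ha : Integrable a) (ha0 : ∀ ξ, 0 ≤ a ξ)
    (hk : Continuous k) (hka : ∀ x, k x = ∫ ξ, a ξ * Real.cos (2 * Real.pi * inner ℝ ξ x))
    (hf : Integrable f) (hg : Integrable g) (hfg : ∀ ξ, ‖fourierReal f ξ‖ ≤ ‖fourierReal g ξ‖)
    (T : ℝ) :
    ∫ p : V × V, truncStar k T (p.1 - p.2) * f p.1 * f p.2 ≤
      ∫ p : V × V, truncStar k T (p.1 - p.2) * g p.1 * g p.2 := by
  obtain ⟨h1, -, h2⟩ := integral_truncStar_form ha hk hka hf T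
  obtain ⟨h3, -, h4⟩ := integral_truncStar_form ha hk hka hg T
  rw [h2, h4]
  have hint : ∀ {f : V → ℝ}, Integrable f → ∀ t : ℝ,
      Integrable (fun ξ => a ξ * ‖fourierReal f (Real.exp t • ξ)‖ ^ 2) := fun {f} hf t => by
    refine ha.mul_bdd (c := (∫ x, |f x|) ^ 2) ?_ (.of_forall fun ξ => ?_)
    · exact (((continuous_fourierReal hf).comp (continuous_const_smul _)).norm.pow 2).aestronglyMeasurable
    · rw [Real.norm_of_nonneg (by positivity)]
      gcongr
      exact norm_fourierReal_le _
  refine integral_mono h1 h3 fun t => integral_mono (hint hf t) (hint hg t) fun ξ => ?_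
  have := ha0 ξ
  have := hfg (Real.exp t • ξ)
  beta_reduce
  gcongr

/-- By scaling, `‖k(eᵗ ·)‖₁ = e^{-dt} ‖k‖₁` with `d = dim V`, which is integrable over `t > 0`
because `d ≥ 1`. -/
theorem integrable_tailStar [Nontrivial V] {k : V → ℝ} (hk : Integrable k) (hkc : Continuous k) :
    Integrable (tailStar k 0) := by
  have hd : 0 < Module.finrank ℝ V := Module.finrank_pos
  have : Integrable (fun z : V × ℝ => k (Real.exp z.2 • z.1))
      ((volume : Measure V).prod (volume.restrict (Ioi (0 : ℝ)))) := by
    rw [integrable_prod_iff' (by fun_prop)]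
    refine ⟨.of_forall fun t => hk.comp_smul (Real.exp_pos t).ne', ?_⟩
    have : ∀ t : ℝ, ∫ x, ‖k (Real.exp t • x)‖ =
        (∫ x, ‖k x‖) * Real.exp (-(Module.finrank ℝ V : ℝ) * t) := fun t => by
      rw [Measure.integral_comp_smul volume (fun x => ‖k x‖), smul_eq_mul, mul_comm]
      congr 1
      rw [abs_of_pos (by positivity), ← Real.exp_nat_mul, ← Real.exp_neg]
      congr 1
      ring
    simp only [this]
    exact (integrableOn_exp_mul_Ioi (by simpa using hd) 0).const_mul _
  exact this.integral_prod_left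

theorem integrable_tailStar' [Nontrivial V] {k : V → ℝ} (hk : Integrable k) (hkc : Continuous k)
    (T : ℝ) : Integrable (tailStar k T) := by
  have := (integrable_tailStar hk hkc).comp_smul (Real.exp_pos T).ne'
  exact this.congr (.of_forall fun x => (tailStar_eq_comp_smul k T x).symm)

theorem tendsto_integral_abs_tailStar [Nontrivial V] (k : V → ℝ) :
    Tendsto (fun T => ∫ x, |tailStar k T x|) atTop (𝓝 0) := by
  have hd : 0 < Module.finrank ℝ V := Module.finrank_pos
  have : ∀ T : ℝ, ∫ x, |tailStar k T x| =
      (∫ x, |tailStar k 0 x|) * Real.exp (-((Module.finrank ℝ V : ℝ) * T)) := fun T => by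
    simp_rw [tailStar_eq_comp_smul k T]
    rw [Measure.integral_comp_smul volume (fun x => |tailStar k 0 x|), smul_eq_mul, mul_comm]
    congr 1
    rw [abs_of_pos (by positivity), ← Real.exp_nat_mul, ← Real.exp_neg]
  refine Tendsto.congr (fun T => (this T).symm) ?_
  have hT : Tendsto (fun T : ℝ => (Module.finrank ℝ V : ℝ) * T) atTop atTop :=
    tendsto_id.const_mul_atTop (by exact_mod_cast hd)
  simpa using! (Real.tendsto_exp_neg_atTop_nhds_zero.comp hT).const_mul (∫ x, |tailStar k 0 x|)

/-- Schur's test for a stationary kernel. -/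
theorem integral_stationary_form_le {τ u : V → ℝ} (hτ : Integrable τ) (hu : Continuous u)
    (huc : HasCompactSupport u) :
    Integrable (fun p : V × V => τ (p.1 - p.2) * u p.1 * u p.2) ∧
    ∫ p : V × V, τ (p.1 - p.2) * u p.1 * u p.2 ≤ (∫ x, |τ x|) * ∫ x, u x ^ 2 := by
  have hu2 : Integrable (fun x => u x ^ 2) := by
    simp_rw [pow_two]
    exact (hu.mul hu).integrable_of_hasCompactSupport huc.mul_right
  have hsnd : Integrable (fun p : V × V => u p.2 ^ 2 * |τ (p.1 - p.2)|) := by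
    have := hu2.convolution_integrand (ContinuousLinearMap.mul ℝ ℝ) hτ.abs
    simpa using! this
  have hsnd' : ∫ p : V × V, u p.2 ^ 2 * |τ (p.1 - p.2)| = (∫ x, |τ x|) * ∫ x, u x ^ 2 := by
    rw [Measure.volume_eq_prod, integral_prod_symm _ hsnd]
    simp only [integral_const_mul, integral_mul_const, integral_sub_right_eq_self (fun x => |τ x|)]
    ring
  have hmeas : AEStronglyMeasurable (fun p : V × V => τ (p.1 - p.2)) := by
    exact hτ.aestronglyMeasurable.comp_quasiMeasurePreserving
      (quasiMeasurePreserving_sub volume volume)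
  have hfst : Integrable (fun p : V × V => u p.1 ^ 2 * |τ (p.1 - p.2)|) ∧
      ∫ p : V × V, u p.1 ^ 2 * |τ (p.1 - p.2)| = (∫ x, |τ x|) * ∫ x, u x ^ 2 := by
    have hint : Integrable (fun p : V × V => u p.1 ^ 2 * |τ (p.1 - p.2)|) := by
      rw [Measure.volume_eq_prod, integrable_prod_iff]
      · refine ⟨.of_forall fun x => (hτ.abs.comp_sub_left x).const_mul (u x ^ 2), ?_⟩
        have : ∀ x : V, ∫ y, ‖u x ^ 2 * |τ (x - y)|‖ = u x ^ 2 * ∫ y, |τ y| := fun x => by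
          rw [← integral_sub_left_eq_self (fun y => |τ y|) volume x, ← integral_const_mul]
          refine integral_congr_ae (.of_forall fun y => ?_)
          exact Real.norm_of_nonneg (by positivity)
        simp only [this]
        exact hu2.mul_const _
      · exact ((hu.comp continuous_fst).pow 2).aestronglyMeasurable.mul hmeas.norm
    refine ⟨hint, ?_⟩
    rw [Measure.volume_eq_prod, integral_prod _ hint]
    simp only [integral_const_mul, integral_mul_const,
      integral_sub_left_eq_self (fun x => |τ x|) volume]
    ring
  have hdom : Integrable (fun p : V × V =>
      (u p.1 ^ 2 * |τ (p.1 - p.2)| + u p.2 ^ 2 * |τ (p.1 - p.2)|) / 2) :=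
    (hfst.1.add hsnd).div_const 2
  -- `2 |u(x) u(y)| ≤ u(x)² + u(y)²` reduces the form to two integrals, each equal to `‖τ‖₁ ‖u‖₂²`.
  have hle : ∀ p : V × V, |τ (p.1 - p.2) * u p.1 * u p.2| ≤
      (u p.1 ^ 2 * |τ (p.1 - p.2)| + u p.2 ^ 2 * |τ (p.1 - p.2)|) / 2 := fun p => by
    rw [abs_mul, abs_mul, ← sq_abs (u p.1), ← sq_abs (u p.2)]
    nlinarith [mul_nonneg (abs_nonneg (τ (p.1 - p.2))) (sq_nonneg (|u p.1| - |u p.2|))]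
  have hint : Integrable (fun p : V × V => τ (p.1 - p.2) * u p.1 * u p.2) :=
    hdom.mono' ((hmeas.mul (hu.comp continuous_fst).aestronglyMeasurable).mul
      (hu.comp continuous_snd).aestronglyMeasurable) (.of_forall hle)
  refine ⟨hint, (integral_mono hint hdom fun p => (le_abs_self _).trans (hle p)).trans_eq ?_⟩
  rw [integral_div, integral_add hfst.1 hsnd, hfst.2, hsnd']
  ring

end Forms

end StarScale

namespace StarScale

open FourierTransform Set Filter Topology
open scoped ContDiff Convolution

/-! ### Nonstationary forms in Fourier variables and the effect of mollification. -/

section BilinearForms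

variable {V : Type*} [NormedAddCommGroup V] [InnerProductSpace ℝ V] [FiniteDimensional ℝ V]
  [MeasurableSpace V] [BorelSpace V]

theorem integral_withLp_prod {E : Type*} [NormedAddCommGroup E] [NormedSpace ℝ E]
    (g : V × V → E) : ∫ z : WithLp 2 (V × V), g (z.fst, z.snd) = ∫ p, g p :=
  (WithLp.volume_preserving_ofLp V V).integral_comp
    (MeasurableEquiv.toLp 2 (V × V)).symm.measurableEmbedding g

theorem integrable_withLp_prod {E : Type*} [NormedAddCommGroup E] {g : V × V → E}
    (hg : Integrable g) : Integrable (fun z : WithLp 2 (V × V) => g (z.fst, z.snd)) :=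
  (WithLp.volume_preserving_ofLp V V).integrable_comp_of_integrable hg

theorem fourierInv_tensor {f : V → ℝ} (ζ : WithLp 2 (V × V)) :
    𝓕⁻ (fun z : WithLp 2 (V × V) => (f z.fst : ℂ) * f z.snd) ζ =
      fourierReal f (-ζ.fst) * fourierReal f (-ζ.snd) := by
  simp only [fourierReal, ← Real.fourierInv_eq_fourier_neg]
  simp only [Real.fourierInv_eq']
  rw [← integral_prod_mul, ← Measure.volume_eq_prod, ← integral_withLp_prod]
  refine integral_congr_ae (.of_forall fun z => ?_)
  simp only [WithLp.prod_inner_apply, smul_eq_mul]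
  rw [mul_mul_mul_comm, ← Complex.exp_add]
  congr 2
  push_cast
  simp only [WithLp.fst, WithLp.snd]
  ring

/-- A quadratic form in terms of the spectral density of its kernel. -/
theorem integral_form_eq_spectral {F : WithLp 2 (V × V) → ℂ} (hF : Integrable F)
    {M : V → V → ℝ} (hM : 𝓕⁻ F = fun z => ((M z.fst z.snd : ℝ) : ℂ)) {f : V → ℝ}
    (hf : Integrable f) :
    ((∫ p : V × V, M p.1 p.2 * f p.1 * f p.2 : ℝ) : ℂ) =
      ∫ ζ, F ζ * (fourierReal f (-ζ.fst) * fourierReal f (-ζ.snd)) := by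
  have hfC : Integrable (fun x => (f x : ℂ)) := hf.ofReal
  have hff := integrable_withLp_prod (hfC.mul_prod hfC)
  have := integral_fourierInv_mul hF hff
  simp only [fourierInv_tensor, hM] at this
  rw [← this, ← integral_withLp_prod]
  refine (integral_ofReal (𝕜 := ℂ)).symm.trans (integral_congr_ae (.of_forall fun z => ?_))
  beta_reduce
  rw [mul_assoc]
  simp

/-- The squared norm of order `-s/2` of a function. -/
noncomputable def energy (s : ℝ) (f : V → ℝ) : ℝ :=
  ∫ ξ, (1 + ‖ξ‖ ^ 2) ^ (-s / 2) * ‖fourierReal f ξ‖ ^ 2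

theorem continuous_one_add_norm_sq_rpow {W : Type*} [NormedAddCommGroup W] (r : ℝ) :
    Continuous (fun ξ : W => (1 + ‖ξ‖ ^ 2) ^ r) := by
  refine Continuous.rpow_const (by fun_prop) fun ξ => Or.inl ?_
  positivity

theorem integrable_one_add_norm_sq_rpow {s : ℝ} (hs : (Module.finrank ℝ V : ℝ) < s) :
    Integrable (fun ξ : V => (1 + ‖ξ‖ ^ 2) ^ (-s / 2)) :=
  integrable_rpow_neg_one_add_norm_sq hs

theorem integrable_energy {s : ℝ} (hs : (Module.finrank ℝ V : ℝ) < s) {f : V → ℝ}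
    (hf : Integrable f) :
    Integrable (fun ξ : V => (1 + ‖ξ‖ ^ 2) ^ (-s / 2) * ‖fourierReal f ξ‖ ^ 2) := by
  refine (integrable_one_add_norm_sq_rpow hs).mul_bdd (c := (∫ x, |f x|) ^ 2) ?_
    (.of_forall fun ξ => ?_)
  · exact ((continuous_fourierReal hf).norm.pow 2).aestronglyMeasurable
  · rw [Real.norm_of_nonneg (by positivity)]
    gcongr
    exact norm_fourierReal_le _

/-- The squared Hilbert-Schmidt norm, between the spaces of order `-s/2` and `s/2`, of the error
made by mollifying both variables. -/
noncomputable def mollificationError (s : ℝ) (F : WithLp 2 (V × V) → ℂ) (θ : V → ℝ) : ℝ :=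
  ∫ ζ, ‖F ζ‖ ^ 2 * ((1 + ‖ζ.fst‖ ^ 2) ^ (s / 2) * (1 + ‖ζ.snd‖ ^ 2) ^ (s / 2)) *
    ‖1 - fourierReal θ (-ζ.fst) * fourierReal θ (-ζ.snd)‖ ^ 2

/-- The isotropic weight controlled by `H^s` on the product dominates the tensor weight of the
Hilbert–Schmidt norm, since both `1 + |ξ₁|²` and `1 + |ξ₂|²` are at most `1 + |ζ|²`. -/
theorem weight_prod_le {V : Type*} [NormedAddCommGroup V] {s : ℝ} (hs : 0 ≤ s) (ζ : WithLp 2 (V × V)) :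
    (1 + ‖ζ.fst‖ ^ 2) ^ (s / 2) * (1 + ‖ζ.snd‖ ^ 2) ^ (s / 2) ≤ (1 + ‖ζ‖ ^ 2) ^ s := by
  rw [show s = s / 2 + s / 2 by ring, Real.rpow_add (by positivity), ← show s = s / 2 + s / 2 by ring,
    WithLp.prod_norm_sq_eq_of_L2]
  gcongr
  · nlinarith [sq_nonneg ‖ζ.snd‖]
  · nlinarith [sq_nonneg ‖ζ.fst‖]

theorem mollificationError_integrand_le {s : ℝ} (hs : 0 ≤ s) {F : WithLp 2 (V × V) → ℂ}
    {θ : V → ℝ} (hθ : ∀ ξ, ‖fourierReal θ ξ‖ ≤ 1) (ζ : WithLp 2 (V × V)) :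
    ‖F ζ‖ ^ 2 * ((1 + ‖ζ.fst‖ ^ 2) ^ (s / 2) * (1 + ‖ζ.snd‖ ^ 2) ^ (s / 2)) *
      ‖1 - fourierReal θ (-ζ.fst) * fourierReal θ (-ζ.snd)‖ ^ 2 ≤
    ‖F ζ‖ ^ 2 * (1 + ‖ζ‖ ^ 2) ^ s * 4 := by
  have h1 : ‖1 - fourierReal θ (-ζ.fst) * fourierReal θ (-ζ.snd)‖ ≤ 2 := by
    refine (norm_sub_le _ _).trans ?_
    rw [norm_one, norm_mul]
    have := mul_le_one₀ (hθ (-ζ.fst)) (norm_nonneg _) (hθ (-ζ.snd))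
    linarith
  have h2 := weight_prod_le hs ζ
  have h3 : ‖1 - fourierReal θ (-ζ.fst) * fourierReal θ (-ζ.snd)‖ ^ 2 ≤ 4 := by
    nlinarith [norm_nonneg (1 - fourierReal θ (-ζ.fst) * fourierReal θ (-ζ.snd))]
  gcongr

theorem aestronglyMeasurable_mollificationError {s : ℝ} {F : WithLp 2 (V × V) → ℂ}
    (hFm : AEStronglyMeasurable F volume) {θ : V → ℝ} (hθi : Integrable θ) :
    AEStronglyMeasurable (fun ζ : WithLp 2 (V × V) =>
      ‖F ζ‖ ^ 2 * ((1 + ‖ζ.fst‖ ^ 2) ^ (s / 2) * (1 + ‖ζ.snd‖ ^ 2) ^ (s / 2)) *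
      ‖1 - fourierReal θ (-ζ.fst) * fourierReal θ (-ζ.snd)‖ ^ 2) volume := by
  have h1 := continuous_fourierReal hθi
  have h2 := continuous_one_add_norm_sq_rpow (W := V) (s / 2)
  have hfst : Continuous (fun ζ : WithLp 2 (V × V) => ζ.fst) := by fun_prop
  have hsnd : Continuous (fun ζ : WithLp 2 (V × V) => ζ.snd) := by fun_prop
  refine ((hFm.norm.pow 2).mul ?_).mul ?_
  · exact ((h2.comp hfst).mul (h2.comp hsnd)).aestronglyMeasurable
  · exact ((continuous_const.sub ((h1.comp hfst.neg).mul (h1.comp hsnd.neg))).norm.pow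
      2).aestronglyMeasurable

/-- Mollification changes a quadratic form with a Sobolev kernel by a small multiple of the
energy. -/
theorem abs_form_sub_form_mollified_le {s : ℝ} (hs : (Module.finrank ℝ V : ℝ) < s)
    {F : WithLp 2 (V × V) → ℂ} (hF : Integrable F)
    (hFs : Integrable (fun ζ => ‖F ζ‖ ^ 2 * (1 + ‖ζ‖ ^ 2) ^ s))
    {M : V → V → ℝ} (hM : 𝓕⁻ F = fun z => ((M z.fst z.snd : ℝ) : ℂ)) {f u θ : V → ℝ}
    (hf : Integrable f) (hu : Integrable u) (hθi : Integrable θ) (hθ : ∀ ξ, ‖fourierReal θ ξ‖ ≤ 1)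
    (hfu : ∀ ξ, fourierReal u ξ = fourierReal θ ξ * fourierReal f ξ) :
    |(∫ p : V × V, M p.1 p.2 * f p.1 * f p.2) - ∫ p : V × V, M p.1 p.2 * u p.1 * u p.2| ≤
      √(mollificationError s F θ) * energy s f := by
  have hs0 : 0 ≤ s := (Nat.cast_nonneg _).trans hs.le
  have hfst : Continuous (fun ζ : WithLp 2 (V × V) => ζ.fst) := by fun_prop
  have hsnd : Continuous (fun ζ : WithLp 2 (V × V) => ζ.snd) := by fun_prop
  have hint : ∀ {g : V → ℝ}, Integrable g →
      Integrable (fun ζ => F ζ * (fourierReal g (-ζ.fst) * fourierReal g (-ζ.snd))) := by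
    intro g hg
    have hc := continuous_fourierReal hg
    refine hF.mul_bdd (c := (∫ x, |g x|) * ∫ x, |g x|)
      ((hc.comp hfst.neg).mul (hc.comp hsnd.neg)).aestronglyMeasurable (.of_forall fun ζ => ?_)
    rw [norm_mul]
    exact mul_le_mul (norm_fourierReal_le _) (norm_fourierReal_le _) (norm_nonneg _)
      (integral_nonneg fun _ => abs_nonneg _)
  -- The exponent `s / 4` makes `v²` the weight of the mollification error and `v⁻²` that of the
  -- energy.
  set v : V → ℝ := fun ξ => (1 + ‖ξ‖ ^ 2) ^ (s / 4) with hv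
  have hvpos : ∀ ξ, 0 < v ξ := fun ξ => by positivity
  have hvsq : ∀ ξ, v ξ ^ 2 = (1 + ‖ξ‖ ^ 2) ^ (s / 2) := fun ξ => by
    rw [hv, ← Real.rpow_mul_natCast (by positivity)]
    congr 1
    push_cast
    ring
  have hvinv : ∀ ξ, ((v ξ)⁻¹) ^ 2 = (1 + ‖ξ‖ ^ 2) ^ (-s / 2) := fun ξ => by
    rw [inv_pow, hvsq, neg_div, Real.rpow_neg (by positivity)]
  have hvc : Continuous v := continuous_one_add_norm_sq_rpow _
  set A : WithLp 2 (V × V) → ℝ := fun ζ => ‖F ζ‖ * (v ζ.fst * v ζ.snd) *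
    ‖1 - fourierReal θ (-ζ.fst) * fourierReal θ (-ζ.snd)‖ with hA
  set B : WithLp 2 (V × V) → ℝ := fun ζ => ((v ζ.fst)⁻¹ * ‖fourierReal f (-ζ.fst)‖) *
    ((v ζ.snd)⁻¹ * ‖fourierReal f (-ζ.snd)‖) with hB
  have hθc := continuous_fourierReal hθi
  have hfc := continuous_fourierReal hf
  have hAm : AEStronglyMeasurable A volume := by
    refine (hF.aestronglyMeasurable.norm.mul
      ((hvc.comp hfst).mul (hvc.comp hsnd)).aestronglyMeasurable).mul ?_
    exact ((continuous_const.sub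
      ((hθc.comp hfst.neg).mul (hθc.comp hsnd.neg))).norm).aestronglyMeasurable
  have hBc : Continuous B :=
    (((hvc.comp hfst).inv₀ fun ζ => (hvpos _).ne').mul (hfc.comp hfst.neg).norm).mul
      (((hvc.comp hsnd).inv₀ fun ζ => (hvpos _).ne').mul (hfc.comp hsnd.neg).norm)
  have hAsq : ∀ ζ, A ζ ^ 2 = ‖F ζ‖ ^ 2 * ((1 + ‖ζ.fst‖ ^ 2) ^ (s / 2) *
      (1 + ‖ζ.snd‖ ^ 2) ^ (s / 2)) *
      ‖1 - fourierReal θ (-ζ.fst) * fourierReal θ (-ζ.snd)‖ ^ 2 := fun ζ => by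
    rw [hA]
    simp only [mul_pow, hvsq]
  set e : V → ℝ := fun ξ => (1 + ‖ξ‖ ^ 2) ^ (-s / 2) * ‖fourierReal f (-ξ)‖ ^ 2 with he
  have hei : Integrable e := by
    have := (integrable_energy hs hf).comp_neg
    simpa only [norm_neg] using this
  have heI : ∫ ξ, e ξ = energy s f := by
    rw [energy, ← integral_neg_eq_self]
    simp only [norm_neg, he, neg_neg]
  have hBsq : ∀ ζ : WithLp 2 (V × V), B ζ ^ 2 = e ζ.fst * e ζ.snd := fun ζ => by
    rw [hB, he]
    simp only [mul_pow, hvinv]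
  have hA2 : Integrable (fun ζ => A ζ ^ 2) := by
    refine (hFs.mul_const 4).mono' (hAm.pow 2) (.of_forall fun ζ => ?_)
    rw [Real.norm_of_nonneg (sq_nonneg _), hAsq]
    exact mollificationError_integrand_le hs0 hθ ζ
  have hB2 : Integrable (fun ζ => B ζ ^ 2) := by
    simp only [hBsq]
    exact integrable_withLp_prod (hei.mul_prod hei)
  have hB2I : ∫ ζ, B ζ ^ 2 = energy s f ^ 2 := by
    simp only [hBsq]
    rw [integral_withLp_prod (fun p : V × V => e p.1 * e p.2), Measure.volume_eq_prod,
      integral_prod_mul, heI, pow_two]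
  have hA2I : ∫ ζ, A ζ ^ 2 = mollificationError s F θ := by
    simp only [hAsq, mollificationError]
  have hen : 0 ≤ energy s f := integral_nonneg fun ξ => by positivity
  -- Cauchy–Schwarz after moving the weights from `f̂ ⊗ f̂` onto `F`. The second factor is a tensor
  -- product, so its `L²` norm is exactly the energy, not its square.
  have hCS : ∫ ζ, A ζ * B ζ ≤ √(mollificationError s F θ) * energy s f := by
    have h2 : ENNReal.ofReal 2 = 2 := by simp
    have := integral_mul_le_Lp_mul_Lq_of_nonneg (μ := (volume : Measure (WithLp 2 (V × V))))
      Real.HolderConjugate.two_two (f := A) (g := B)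
      (.of_forall fun ζ => by
        have := hvpos ζ.fst
        have := hvpos ζ.snd
        simp only [hA, Pi.zero_apply]
        positivity)
      (.of_forall fun ζ => by
        have := hvpos ζ.fst
        have := hvpos ζ.snd
        simp only [hB, Pi.zero_apply]
        positivity)
      (by rw [h2]; exact (memLp_two_iff_integrable_sq hAm).mpr hA2)
      (by rw [h2]; exact (memLp_two_iff_integrable_sq hBc.aestronglyMeasurable).mpr hB2)
    simp only [Real.rpow_two] at this
    rw [hA2I, hB2I, ← Real.sqrt_eq_rpow, ← Real.sqrt_eq_rpow, Real.sqrt_sq hen] at this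
    exact this
  have hAB : Integrable (fun ζ => A ζ * B ζ) :=
    ((memLp_two_iff_integrable_sq hAm).mpr hA2).integrable_mul
      ((memLp_two_iff_integrable_sq hBc.aestronglyMeasurable).mpr hB2)
  refine le_trans ?_ hCS
  rw [← Real.norm_eq_abs, ← Complex.norm_real, Complex.ofReal_sub, integral_form_eq_spectral hF hM hf,
    integral_form_eq_spectral hF hM hu, ← integral_sub (hint hf) (hint hu)]
  refine norm_integral_le_of_norm_le hAB (.of_forall fun ζ => ?_)
  have h1 := (hvpos ζ.fst).ne'
  have h2 := (hvpos ζ.snd).ne'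
  rw [hfu, hfu, show F ζ * (fourierReal f (-ζ.fst) * fourierReal f (-ζ.snd)) -
    F ζ * (fourierReal θ (-ζ.fst) * fourierReal f (-ζ.fst) *
      (fourierReal θ (-ζ.snd) * fourierReal f (-ζ.snd))) = F ζ *
      (1 - fourierReal θ (-ζ.fst) * fourierReal θ (-ζ.snd)) *
      (fourierReal f (-ζ.fst) * fourierReal f (-ζ.snd)) by ring, norm_mul, norm_mul, norm_mul]
  apply le_of_eq
  simp only [hA, hB]
  field_simp

end BilinearForms

end StarScale

namespace StarScale

open FourierTransform Set Filter Topology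
open scoped ContDiff Convolution

/-! ### Choice of mollifiers and their smoothing bounds. -/

section Mollification

variable {V : Type*} [NormedAddCommGroup V] [InnerProductSpace ℝ V] [FiniteDimensional ℝ V]
  [MeasurableSpace V] [BorelSpace V]

variable (V) in
/-- A smooth bump supported in the ball of radius `1 / (n + 1)`. -/
noncomputable def shrinkingBump (n : ℕ) : ContDiffBump (0 : V) :=
  ⟨1 / (n + 1) / 2, 1 / (n + 1), by positivity, half_lt_self (by positivity)⟩

/-- The transform at `ξ` is the convolution of the bump with the character `exp(2πi⟨·, ξ⟩)`, taken
at `0`; approximate identities converge to the value `1` there. -/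
theorem tendsto_fourierReal_shrinkingBump (ξ : V) :
    Tendsto (fun n => fourierReal ((shrinkingBump V n).normed volume) ξ) atTop (𝓝 1) := by
  have h := ContDiffBump.convolution_tendsto_right_of_continuous (μ := (volume : Measure V))
    (φ := shrinkingBump V) (l := atTop)
    (g := fun x => Complex.exp (↑(2 * Real.pi * inner ℝ x ξ) * Complex.I))
    tendsto_one_div_add_atTop_nhds_zero_nat (by fun_prop) 0
  simp only [inner_zero_left, mul_zero, Complex.ofReal_zero, zero_mul, Complex.exp_zero] at h
  refine h.congr fun n => ?_
  rw [fourierReal, Real.fourier_eq', convolution_def]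
  refine integral_congr_ae (.of_forall fun x => ?_)
  simp only [ContinuousLinearMap.lsmul_apply, Complex.real_smul, smul_eq_mul, zero_sub,
    inner_neg_left]
  rw [mul_comm]
  congr 3
  ring_nf

/-- The error integrand tends to `0` pointwise along shrinking bumps and is dominated by `4 |F|² (1
+ |ζ|²)^s`, so dominated convergence applies. -/
theorem exists_mollifier {s : ℝ} (hs : 0 ≤ s) {F : WithLp 2 (V × V) → ℂ}
    (hFm : AEStronglyMeasurable F volume)
    (hFs : Integrable (fun ζ => ‖F ζ‖ ^ 2 * (1 + ‖ζ‖ ^ 2) ^ s)) {ε η : ℝ} (hε : 0 < ε)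
    (hη : 0 < η) :
    ∃ θ : V → ℝ, ContDiff ℝ ∞ θ ∧ HasCompactSupport θ ∧
      Function.support θ ⊆ Metric.closedBall 0 η ∧ (∀ ξ, ‖fourierReal θ ξ‖ ≤ 1) ∧
      √(mollificationError s F θ) ≤ ε := by
  set θ : ℕ → V → ℝ := fun n => (shrinkingBump V n).normed volume with hθ
  have hθi : ∀ n, Integrable (θ n) := fun n => (shrinkingBump V n).integrable_normed
  have hθ1 : ∀ n ξ, ‖fourierReal (θ n) ξ‖ ≤ 1 := fun n ξ => by
    refine (norm_fourierReal_le ξ).trans_eq ?_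
    rw [← (shrinkingBump V n).integral_normed (μ := volume)]
    exact integral_congr_ae (.of_forall fun x => abs_of_nonneg ((shrinkingBump V n).nonneg_normed x))
  have hlim : Tendsto (fun n => mollificationError s F (θ n)) atTop (𝓝 0) := by
    rw [show (0 : ℝ) = ∫ ζ : WithLp 2 (V × V), (0 : ℝ) by simp]
    refine tendsto_integral_of_dominated_convergence _
      (fun n => aestronglyMeasurable_mollificationError hFm (hθi n)) (hFs.mul_const 4)
      (fun n => .of_forall fun ζ => ?_) (.of_forall fun ζ => ?_)
    · rw [Real.norm_of_nonneg (by positivity)]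
      exact mollificationError_integrand_le hs (hθ1 n) ζ
    · have h1 := (tendsto_fourierReal_shrinkingBump (-ζ.fst)).mul
        (tendsto_fourierReal_shrinkingBump (-ζ.snd))
      have h2 := ((h1.const_sub 1).norm.pow 2).const_mul
        (‖F ζ‖ ^ 2 * ((1 + ‖ζ.fst‖ ^ 2) ^ (s / 2) * (1 + ‖ζ.snd‖ ^ 2) ^ (s / 2)))
      simpa using h2
  have hlim' := (Real.continuous_sqrt.tendsto 0).comp hlim
  rw [Real.sqrt_zero] at hlim'
  have hη' : ∀ᶠ n : ℕ in atTop, 1 / ((n : ℝ) + 1) < η :=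
    tendsto_one_div_add_atTop_nhds_zero_nat.eventually_lt_const hη
  obtain ⟨n, hn1, hn2⟩ := ((hlim'.eventually_lt_const hε).and hη').exists
  refine ⟨θ n, (shrinkingBump V n).contDiff_normed, (shrinkingBump V n).hasCompactSupport_normed,
    ?_, hθ1 n, hn1.le⟩
  rw [hθ, ContDiffBump.support_normed_eq]
  exact Metric.ball_subset_closedBall.trans (Metric.closedBall_subset_closedBall hn2.le)

theorem fourierReal_convolution {f θ : V → ℝ} (hf : Integrable f) (hθ : Integrable θ) (ξ : V) :
    fourierReal (f ⋆[ContinuousLinearMap.mul ℝ ℝ] θ) ξ = fourierReal θ ξ * fourierReal f ξ := by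
  have hfC : Integrable (fun x => (f x : ℂ)) := hf.ofReal
  have hθC : Integrable (fun x => (θ x : ℂ)) := hθ.ofReal
  rw [mul_comm, fourierReal, fourierReal, fourierReal, ← Real.fourier_mul_convolution_eq hfC hθC]
  refine congrArg (fun g : V → ℂ => 𝓕 g ξ) (funext fun x => ?_)
  rw [convolution_def, convolution_def]
  refine (integral_ofReal (𝕜 := ℂ)).symm.trans ?_
  simp

/-- Rapid decay of the transform of a test function. The constant depends on `θ`, which is why the
truncation scale is chosen after the mollifier. -/
theorem exists_norm_fourierReal_sq_le {s : ℝ} {θ : V → ℝ} (hθ : ContDiff ℝ ∞ θ)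
    (hθc : HasCompactSupport θ) :
    ∃ C, ∀ ξ, ‖fourierReal θ ξ‖ ^ 2 ≤ C * (1 + ‖ξ‖ ^ 2) ^ (-s / 2) := by
  have hC : HasCompactSupport (fun x => (θ x : ℂ)) := hθc.comp_left Complex.ofReal_zero
  have hθC : ContDiff ℝ ∞ (fun x => (θ x : ℂ)) := Complex.ofRealCLM.contDiff.comp hθ
  set n := ⌈|s|⌉₊ with hn
  set C := 2 ^ n * (Finset.Iic (n, 0)).sup (fun m => SchwartzMap.seminorm ℝ m.1 m.2)
    (𝓕 (hC.toSchwartzMap hθC)) with hCdef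
  have hb : ∀ ξ, (1 + ‖ξ‖) ^ n * ‖fourierReal θ ξ‖ ≤ C := fun ξ => by
    have := SchwartzMap.one_add_le_sup_seminorm_apply (𝕜 := ℝ) (m := (n, 0)) (k := n) (n := 0)
      le_rfl le_rfl (𝓕 (hC.toSchwartzMap hθC)) ξ
    rw [norm_iteratedFDeriv_zero, SchwartzMap.fourier_coe] at this
    exact this
  refine ⟨C ^ 2, fun ξ => ?_⟩
  have h1 : (1 + ‖ξ‖ ^ 2) ^ (s / 2) ≤ ((1 + ‖ξ‖) ^ n) ^ 2 := by
    have h2 : 1 + ‖ξ‖ ^ 2 ≤ (1 + ‖ξ‖) ^ 2 := by nlinarith [norm_nonneg ξ]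
    have h3 : (1 : ℝ) ≤ 1 + ‖ξ‖ ^ 2 := by nlinarith [sq_nonneg ‖ξ‖]
    calc (1 + ‖ξ‖ ^ 2) ^ (s / 2) ≤ (1 + ‖ξ‖ ^ 2) ^ (n : ℝ) := by
          refine Real.rpow_le_rpow_of_exponent_le h3 ?_
          have := Nat.le_ceil |s|
          have := le_abs_self s
          have := abs_nonneg s
          rw [hn]
          linarith
      _ ≤ ((1 + ‖ξ‖) ^ 2) ^ n := by
          rw [Real.rpow_natCast]
          gcongr
      _ = _ := by rw [← pow_mul, ← pow_mul, mul_comm]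
  have hpos : (0 : ℝ) < (1 + ‖ξ‖ ^ 2) ^ (s / 2) := by positivity
  rw [neg_div, Real.rpow_neg (by positivity), ← div_eq_mul_inv, le_div_iff₀ hpos]
  calc ‖fourierReal θ ξ‖ ^ 2 * (1 + ‖ξ‖ ^ 2) ^ (s / 2)
      ≤ ‖fourierReal θ ξ‖ ^ 2 * ((1 + ‖ξ‖) ^ n) ^ 2 := by gcongr
    _ = ((1 + ‖ξ‖) ^ n * ‖fourierReal θ ξ‖) ^ 2 := by ring
    _ ≤ C ^ 2 := by
        gcongr
        exact hb ξ

theorem integral_sq_eq_integral_norm_fourierReal_sq {u : V → ℝ} (hu : ContDiff ℝ ∞ u)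
    (huc : HasCompactSupport u) : ∫ x, u x ^ 2 = ∫ ξ, ‖fourierReal u ξ‖ ^ 2 := by
  have hC : HasCompactSupport (fun x => (u x : ℂ)) := huc.comp_left Complex.ofReal_zero
  have huC : ContDiff ℝ ∞ (fun x => (u x : ℂ)) := Complex.ofRealCLM.contDiff.comp hu
  have := SchwartzMap.integral_norm_sq_fourier (hC.toSchwartzMap huC)
  rw [SchwartzMap.fourier_coe] at this
  have h2 : ∀ x, ‖hC.toSchwartzMap huC x‖ ^ 2 = u x ^ 2 := fun x => by
    change ‖(u x : ℂ)‖ ^ 2 = _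
    rw [Complex.norm_real, Real.norm_eq_abs, sq_abs]
  simp only [h2] at this
  exact this.symm

/-- The `L²` norm of a mollified function is bounded by the energy. -/
theorem integral_sq_mollified_le {s : ℝ} (hs : (Module.finrank ℝ V : ℝ) < s) {f u θ : V → ℝ}
    (hf : Integrable f) (hu : ContDiff ℝ ∞ u) (huc : HasCompactSupport u)
    (hfu : ∀ ξ, fourierReal u ξ = fourierReal θ ξ * fourierReal f ξ) {C : ℝ}
    (hC : ∀ ξ, ‖fourierReal θ ξ‖ ^ 2 ≤ C * (1 + ‖ξ‖ ^ 2) ^ (-s / 2)) :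
    ∫ x, u x ^ 2 ≤ C * energy s f := by
  rw [integral_sq_eq_integral_norm_fourierReal_sq hu huc, energy, ← integral_const_mul]
  refine integral_mono_of_nonneg (.of_forall fun ξ => by positivity)
    ((integrable_energy hs hf).const_mul C) (.of_forall fun ξ => ?_)
  beta_reduce
  rw [hfu, norm_mul, mul_pow, ← mul_assoc]
  gcongr
  exact hC ξ

end Mollification

end StarScale

namespace StarScale

open FourierTransform Set Filter Topology
open scoped ContDiff Convolution

/-! ### Convergence of star-scale integrals off the origin. -/

section StarIntegrals

variable {V : Type*} [NormedAddCommGroup V] [NormedSpace ℝ V]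

/-- Away from the origin the integrand vanishes once `eᵗ |x| ≥ 1`, so only a bounded range of `t`
matters. -/
theorem integrableOn_star {k : V → ℝ} (hk : Continuous k) (hk1 : ∀ x, 1 ≤ ‖x‖ → k x = 0) {x : V}
    (hx : x ≠ 0) : IntegrableOn (fun t : ℝ => k (Real.exp t • x)) (Ioi 0) := by
  have hx' : 0 < ‖x‖ := norm_pos_iff.mpr hx
  have hc : Continuous (fun t : ℝ => k (Real.exp t • x)) := by fun_prop
  have h1 : IntegrableOn (fun t : ℝ => k (Real.exp t • x)) (Icc 0 (Real.log (1 / ‖x‖))) :=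
    hc.continuousOn.integrableOn_Icc
  have h2 : IntegrableOn (fun t : ℝ => k (Real.exp t • x)) (Ioi (Real.log (1 / ‖x‖))) := by
    refine integrableOn_zero.congr_fun (fun t ht => ?_) measurableSet_Ioi
    symm
    apply hk1
    have := Real.exp_lt_exp.mpr ht
    rw [Real.exp_log (by positivity), div_lt_iff₀ hx'] at this
    rw [norm_smul, Real.norm_of_nonneg (Real.exp_pos t).le]
    exact this.le
  refine (h1.union h2).mono_set fun t ht => ?_
  rcases le_or_gt t (Real.log (1 / ‖x‖)) with h | h
  · exact Or.inl ⟨le_of_lt ht, h⟩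
  · exact Or.inr h

theorem tailStar_zero_eq {k : V → ℝ} (hk : Continuous k) (hk1 : ∀ x, 1 ≤ ‖x‖ → k x = 0) {x : V}
    (hx : x ≠ 0) {T : ℝ} (hT : 0 ≤ T) : tailStar k 0 x = truncStar k T x + tailStar k T x := by
  have h := integrableOn_star hk hk1 hx
  rw [tailStar, truncStar, tailStar, ← setIntegral_union (Ioc_disjoint_Ioi le_rfl) measurableSet_Ioi
    (h.mono_set Ioc_subset_Ioi_self) (h.mono_set (Ioi_subset_Ioi hT)), Ioc_union_Ioi_eq_Ioi hT]

end StarIntegrals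

/-! ### The Bessel kernel and positivity of the truncated kernel. -/

section Positivity

variable {V : Type*} [NormedAddCommGroup V] [InnerProductSpace ℝ V] [FiniteDimensional ℝ V]
  [MeasurableSpace V] [BorelSpace V]

theorem integrable_form_of_bounded {M : V → V → ℝ} (hM : Continuous (fun p : V × V => M p.1 p.2))
    {C : ℝ} (hC : ∀ x y, |M x y| ≤ C) {f : V → ℝ} (hf : Integrable f) :
    Integrable (fun p : V × V => M p.1 p.2 * f p.1 * f p.2) := by
  have hff : Integrable (fun p : V × V => f p.1 * f p.2) := hf.mul_prod hf
  refine (hff.bdd_mul (c := C) hM.aestronglyMeasurable (.of_forall fun p => hC _ _)).congr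
    (.of_forall fun p => ?_)
  ring

/-- The stationary kernel with spectral density `(1 + |ξ|²)^{-s/2}`. -/
noncomputable def besselKernel (s : ℝ) (x : V) : ℝ :=
  ∫ ξ : V, (1 + ‖ξ‖ ^ 2) ^ (-s / 2) * Real.cos (2 * Real.pi * inner ℝ ξ x)

theorem continuous_besselKernel {s : ℝ} (hs : (Module.finrank ℝ V : ℝ) < s) :
    Continuous (besselKernel s : V → ℝ) := by
  refine continuous_of_dominated (bound := fun ξ : V => (1 + ‖ξ‖ ^ 2) ^ (-s / 2)) (fun x => ?_)
    (fun x => .of_forall fun ξ => ?_) (integrable_one_add_norm_sq_rpow hs)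
    (.of_forall fun ξ => by fun_prop)
  · exact ((continuous_one_add_norm_sq_rpow _).mul (by fun_prop)).aestronglyMeasurable
  · rw [norm_mul, Real.norm_of_nonneg (by positivity)]
    exact mul_le_of_le_one_right (by positivity) (Real.abs_cos_le_one _)

theorem abs_besselKernel_le {s : ℝ} (hs : (Module.finrank ℝ V : ℝ) < s) (x : V) :
    |besselKernel s x| ≤ ∫ ξ : V, (1 + ‖ξ‖ ^ 2) ^ (-s / 2) := by
  rw [← Real.norm_eq_abs, besselKernel]
  refine norm_integral_le_of_norm_le (integrable_one_add_norm_sq_rpow hs) (.of_forall fun ξ => ?_)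
  rw [norm_mul, Real.norm_of_nonneg (by positivity)]
  exact mul_le_of_le_one_right (by positivity) (Real.abs_cos_le_one _)

theorem besselKernel_neg (s : ℝ) (x : V) : besselKernel s (-x) = besselKernel s x := by
  simp [besselKernel, inner_neg_right]

/-- This identity is the reason for the choice of perturbation: adding `ε R` adds exactly `ε` times
the energy in which all error terms are measured. -/
theorem integral_besselKernel_form {s : ℝ} (hs : (Module.finrank ℝ V : ℝ) < s) {f : V → ℝ}
    (hf : Integrable f) :
    ∫ p : V × V, besselKernel s (p.1 - p.2) * f p.1 * f p.2 = energy s f := by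
  have := integral_spectral_form (integrable_one_add_norm_sq_rpow hs) hf 1
  simpa [one_smul, besselKernel, energy] using this

/-- The diagonal is null in positive dimension, so identities between kernels that fail only at the
singularity may be used under the integral. -/
theorem ae_fst_ne_snd [Nontrivial V] : ∀ᵐ p : V × V, p.1 ≠ p.2 := by
  have h : ∀ᵐ x : V, x ≠ 0 := by
    rw [ae_iff]
    simp
  filter_upwards [(quasiMeasurePreserving_sub (volume : Measure V) volume).ae h] with p hp
  exact sub_ne_zero.mp hp

open scoped Pointwise in
theorem tsupport_convolution_subset {f θ : V → ℝ} (hfc : HasCompactSupport f) {S : Set V}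
    (hfS : tsupport f ⊆ S) {η : ℝ} (hθ : Function.support θ ⊆ Metric.closedBall 0 η) :
    tsupport (f ⋆[ContinuousLinearMap.mul ℝ ℝ] θ) ⊆ Metric.cthickening η S := by
  have hK : IsClosed (tsupport f + Metric.closedBall (0 : V) η) :=
    (hfc.isCompact.add (isCompact_closedBall 0 η)).isClosed
  have hsub : Function.support (f ⋆[ContinuousLinearMap.mul ℝ ℝ] θ) ⊆
      tsupport f + Metric.closedBall (0 : V) η :=
    (support_convolution_subset (ContinuousLinearMap.mul ℝ ℝ)).trans
      (Set.add_subset_add (subset_tsupport f) hθ)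
  intro z hz
  obtain ⟨x, hx, y, hy, rfl⟩ := Set.mem_add.mp (closure_minimal hsub hK hz)
  refine Metric.mem_cthickening_of_dist_le _ x η S (hfS hx) ?_
  rw [dist_eq_norm, add_sub_cancel_left]
  exact mem_closedBall_zero_iff.mp hy

theorem exists_mollified {f θ : V → ℝ} (hθ : ContDiff ℝ ∞ θ) (hθc : HasCompactSupport θ) {η : ℝ}
    (hθs : Function.support θ ⊆ Metric.closedBall 0 η) (hf : Continuous f)
    (hfc : HasCompactSupport f) {S : Set V} (hfS : tsupport f ⊆ S) :
    ∃ u : V → ℝ, ContDiff ℝ ∞ u ∧ HasCompactSupport u ∧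
      (∀ ξ, fourierReal u ξ = fourierReal θ ξ * fourierReal f ξ) ∧
      tsupport u ⊆ Metric.cthickening η S :=
  ⟨f ⋆[ContinuousLinearMap.mul ℝ ℝ] θ,
    hθc.contDiff_convolution_right (n := ⊤) _ hf.locallyIntegrable hθ, hfc.convolution _ hθc,
    fourierReal_convolution (hf.integrable_of_hasCompactSupport hfc)
      (hθ.continuous.integrable_of_hasCompactSupport hθc),
    tsupport_convolution_subset hfc hfS hθs⟩

/-- Removing the star-scale integral over very small scales preserves positivity, at the price of a
small multiple of a Bessel kernel. -/
theorem exists_nonneg_form_truncStar [Nontrivial V] {s : ℝ} (hs : (Module.finrank ℝ V : ℝ) < s)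
    {F : WithLp 2 (V × V) → ℂ} (hF : Integrable F)
    (hFs : Integrable (fun ζ => ‖F ζ‖ ^ 2 * (1 + ‖ζ‖ ^ 2) ^ s))
    {M : V → V → ℝ} (hM : 𝓕⁻ F = fun z => ((M z.fst z.snd : ℝ) : ℂ))
    (hMc : Continuous (fun p : V × V => M p.1 p.2)) {B : ℝ} (hMb : ∀ x y, |M x y| ≤ B)
    {k a : V → ℝ} (hk : Continuous k) (hkc : HasCompactSupport k) (hk1 : ∀ x, 1 ≤ ‖x‖ → k x = 0)
    (ha : Integrable a) (ha0 : ∀ ξ, 0 ≤ a ξ)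
    (hka : ∀ x, k x = ∫ ξ, a ξ * Real.cos (2 * Real.pi * inner ℝ ξ x))
    {D D' : Set V} {η : ℝ} (hη : 0 < η) (hD : Metric.cthickening η D' ⊆ D)
    (hpos : ∀ u : V → ℝ, Continuous u → HasCompactSupport u → tsupport u ⊆ D →
      0 ≤ ∫ p : V × V, (M p.1 p.2 + tailStar k 0 (p.1 - p.2)) * u p.1 * u p.2)
    {ε : ℝ} (hε : 0 < ε) :
    ∃ T : ℝ, 0 ≤ T ∧ ∀ f : V → ℝ, Continuous f → HasCompactSupport f → tsupport f ⊆ D' →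
      0 ≤ ∫ p : V × V, (M p.1 p.2 + truncStar k T (p.1 - p.2) +
        ε * besselKernel s (p.1 - p.2)) * f p.1 * f p.2 := by
  have hs0 : 0 ≤ s := (Nat.cast_nonneg _).trans hs.le
  have hki : Integrable k := hk.integrable_of_hasCompactSupport hkc
  obtain ⟨θ, hθ, hθc, hθs, hθ1, hθe⟩ := exists_mollifier hs0 hF.aestronglyMeasurable hFs
    (half_pos hε) hη
  obtain ⟨C, hC⟩ := exists_norm_fourierReal_sq_le (s := s) hθ hθc
  have hlim : Tendsto (fun T => (∫ x, |tailStar k T x|) * C) atTop (𝓝 0) := by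
    simpa using (tendsto_integral_abs_tailStar k).mul_const C
  -- Half of `ε` has paid for mollification; the other half pays for the discarded scales, with `C`
  -- already fixed by `θ`.
  obtain ⟨T, hTC, hT0⟩ := ((hlim.eventually_lt_const (half_pos hε)).and
    (eventually_ge_atTop (0 : ℝ))).exists
  refine ⟨T, hT0, fun f hf hfc hfD => ?_⟩
  have hfi : Integrable f := hf.integrable_of_hasCompactSupport hfc
  have hθi : Integrable θ := hθ.continuous.integrable_of_hasCompactSupport hθc
  obtain ⟨u, hus, huc, hfu, huD⟩ := exists_mollified hθ hθc hθs hf hfc hfD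
  have hui : Integrable u := hus.continuous.integrable_of_hasCompactSupport huc
  have hE : 0 ≤ energy s f := integral_nonneg fun ξ => by positivity
  have iM := integrable_form_of_bounded hMc hMb hfi
  have iMu := integrable_form_of_bounded hMc hMb hui
  obtain ⟨-, iS, -⟩ := integral_truncStar_form ha hk hka hfi T
  obtain ⟨-, iSu, -⟩ := integral_truncStar_form ha hk hka hui T
  obtain ⟨iTu, hTu⟩ := integral_stationary_form_le (integrable_tailStar' hki hk T) hus.continuous huc
  have iR : Integrable (fun p : V × V => besselKernel s (p.1 - p.2) * f p.1 * f p.2) :=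
    integrable_form_of_bounded (M := fun x y => besselKernel s (x - y))
      ((continuous_besselKernel hs).comp (by fun_prop)) (fun _ _ => abs_besselKernel_le hs _) hfi
  have h1 := abs_form_sub_form_mollified_le hs hF hFs hM hfi hui hθi hθ1 hfu
  have h1' : √(mollificationError s F θ) * energy s f ≤ ε / 2 * energy s f := by gcongr
  have h2 := integral_truncStar_form_mono ha ha0 hk hka hui hfi (fun ξ => by
    rw [hfu, norm_mul]
    exact mul_le_of_le_one_left (norm_nonneg _) (hθ1 ξ)) T
  -- Positivity of the original kernel is used on the mollified function only, whose support may
  -- leave `D'` by at most `η`.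
  have h3 := hpos u hus.continuous huc (huD.trans hD)
  have h4 : ∫ p : V × V, (M p.1 p.2 + tailStar k 0 (p.1 - p.2)) * u p.1 * u p.2 =
      (∫ p : V × V, M p.1 p.2 * u p.1 * u p.2) +
      (∫ p : V × V, truncStar k T (p.1 - p.2) * u p.1 * u p.2) +
      ∫ p : V × V, tailStar k T (p.1 - p.2) * u p.1 * u p.2 := by
    have e1 : (fun p : V × V => (M p.1 p.2 + tailStar k 0 (p.1 - p.2)) * u p.1 * u p.2) =ᵐ[volume]
        fun p => M p.1 p.2 * u p.1 * u p.2 + truncStar k T (p.1 - p.2) * u p.1 * u p.2 +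
          tailStar k T (p.1 - p.2) * u p.1 * u p.2 := by
      filter_upwards [ae_fst_ne_snd] with p hp
      rw [tailStar_zero_eq hk hk1 (sub_ne_zero.mpr hp) hT0]
      ring
    rw [integral_congr_ae e1, ← integral_add iMu iSu]
    exact integral_add (iMu.add iSu) iTu
  have h5 : (∫ x, |tailStar k T x|) * ∫ x, u x ^ 2 ≤ ε / 2 * energy s f := by
    calc (∫ x, |tailStar k T x|) * ∫ x, u x ^ 2
        ≤ (∫ x, |tailStar k T x|) * (C * energy s f) := by
          gcongr
          exact integral_sq_mollified_le hs hfi hus huc hfu hC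
      _ = (∫ x, |tailStar k T x|) * C * energy s f := by ring
      _ ≤ _ := by gcongr
  have h6 : ∫ p : V × V, (M p.1 p.2 + truncStar k T (p.1 - p.2) +
        ε * besselKernel s (p.1 - p.2)) * f p.1 * f p.2 =
      (∫ p : V × V, M p.1 p.2 * f p.1 * f p.2) +
      (∫ p : V × V, truncStar k T (p.1 - p.2) * f p.1 * f p.2) + ε * energy s f := by
    rw [← integral_besselKernel_form hs hfi, ← integral_const_mul, ← integral_add iM iS]
    refine Eq.trans ?_ (integral_add (iM.add iS) (iR.const_mul ε))
    refine integral_congr_ae (.of_forall fun p => ?_)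
    beta_reduce
    ring
  rw [h6]
  have h7 := (abs_le.mp h1).1
  linarith

end Positivity

end StarScale

namespace StarScale

open FourierTransform Set Filter Topology
open scoped ContDiff

/-! ### Hölder bounds from spectral densities. -/

section Holder

/-- For `r ≤ 1` use the linear bound and `r ≤ r^α`; for `r ≥ 1` use the constant bound and `1 ≤
r^α`. This turns a bounded Lipschitz estimate into a global Hölder one. -/
theorem le_max_mul_rpow {c₁ c₂ r t α : ℝ} (hα : 0 < α) (hα1 : α ≤ 1) (hr : 0 ≤ r) (h1 : t ≤ c₁)
    (h2 : t ≤ c₂ * r) (hc₁ : 0 ≤ c₁) : t ≤ max c₁ c₂ * r ^ α := by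
  have hm : 0 ≤ max c₁ c₂ := hc₁.trans (le_max_left _ _)
  rcases le_total r 1 with h | h
  · have h3 : r ≤ r ^ α := by
      rcases hr.eq_or_lt with h0 | h0
      · rw [← h0]; positivity
      · simpa using Real.rpow_le_rpow_of_exponent_ge h0 h hα1
    calc t ≤ c₂ * r := h2
      _ ≤ max c₁ c₂ * r := by gcongr; exact le_max_right _ _
      _ ≤ _ := by gcongr
  · have h3 : 1 ≤ r ^ α := Real.one_le_rpow h hα.le
    calc t ≤ c₁ := h1
      _ ≤ max c₁ c₂ * 1 := by rw [mul_one]; exact le_max_left _ _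
      _ ≤ _ := by gcongr

theorem holderOnWith_of_dist_le {X Y : Type*} [PseudoMetricSpace X] [PseudoMetricSpace Y]
    {f : X → Y} {C α : NNReal} (h : ∀ x y, dist (f x) (f y) ≤ C * dist x y ^ (α : ℝ)) (S : Set X) :
    HolderOnWith C α f S := fun x _ y _ => by
  rw [edist_dist, edist_dist, ENNReal.ofReal_rpow_of_nonneg dist_nonneg α.coe_nonneg,
    ← ENNReal.ofReal_coe_nnreal, ← ENNReal.ofReal_mul C.coe_nonneg]
  exact ENNReal.ofReal_le_ofReal (h x y)

variable {V : Type*} [NormedAddCommGroup V] [InnerProductSpace ℝ V] [FiniteDimensional ℝ V]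
  [MeasurableSpace V] [BorelSpace V]

theorem norm_exp_sub_exp_le (x y : ℝ) :
    ‖Complex.exp (x * Complex.I) - Complex.exp (y * Complex.I)‖ ≤ |x - y| := by
  have h : Complex.exp (x * Complex.I) - Complex.exp (y * Complex.I) =
      Complex.exp (y * Complex.I) * (Complex.exp (Complex.I * ((x - y : ℝ) : ℂ)) - 1) := by
    rw [mul_sub, ← Complex.exp_add, mul_one]
    congr 2
    push_cast
    ring
  rw [h, norm_mul, Complex.norm_exp_ofReal_mul_I, one_mul]
  exact Real.norm_exp_I_mul_ofReal_sub_one_le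

/-- Interpolating between the bounds `2` and `|a - b|` gives `|e^{ia} - e^{ib}| ≤ 2 |a - b|^α`; the
factor `|ζ|^α` is absorbed by the moment of `F`. -/
theorem norm_fourierInv_sub_le {F : V → ℂ} (hF : Integrable F) {α : ℝ} (hα : 0 < α) (hα1 : α ≤ 1)
    (hFα : Integrable (fun ζ => ‖F ζ‖ * ‖ζ‖ ^ α)) (x y : V) :
    ‖𝓕⁻ F x - 𝓕⁻ F y‖ ≤ (2 * (2 * Real.pi) ^ α * ∫ ζ, ‖F ζ‖ * ‖ζ‖ ^ α) * ‖x - y‖ ^ α := by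
  have hint : ∀ x : V, Integrable (fun ζ =>
      Complex.exp (↑(2 * Real.pi * inner ℝ ζ x) * Complex.I) • F ζ) := fun x => by
    simp only [smul_eq_mul]
    refine hF.bdd_mul (c := 1) (by fun_prop) (.of_forall fun ζ => ?_)
    rw [Complex.norm_exp_ofReal_mul_I]
  rw [Real.fourierInv_eq', Real.fourierInv_eq', ← integral_sub (hint x) (hint y),
    mul_right_comm, ← integral_const_mul]
  refine norm_integral_le_of_norm_le (hFα.const_mul _) (.of_forall fun ζ => ?_)
  rw [← sub_smul, norm_smul]
  have h1 : ‖Complex.exp (↑(2 * Real.pi * inner ℝ ζ x) * Complex.I) -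
      Complex.exp (↑(2 * Real.pi * inner ℝ ζ y) * Complex.I)‖ ≤
      max 2 1 * (2 * Real.pi * (‖ζ‖ * ‖x - y‖)) ^ α := by
    refine le_max_mul_rpow hα hα1 (by positivity) ?_ ?_ zero_le_two
    · refine (norm_sub_le _ _).trans ?_
      rw [Complex.norm_exp_ofReal_mul_I, Complex.norm_exp_ofReal_mul_I]
      norm_num
    · refine (norm_exp_sub_exp_le _ _).trans ?_
      rw [one_mul, ← mul_sub, ← inner_sub_right, abs_mul, abs_of_pos Real.two_pi_pos]
      gcongr
      exact abs_real_inner_le_norm _ _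
  rw [max_eq_left one_le_two, Real.mul_rpow Real.two_pi_pos.le (by positivity),
    Real.mul_rpow (norm_nonneg ζ) (norm_nonneg (x - y))] at h1
  calc _ ≤ 2 * ((2 * Real.pi) ^ α * (‖ζ‖ ^ α * ‖x - y‖ ^ α)) * ‖F ζ‖ := by gcongr
    _ = _ := by ring

theorem rpow_le_one_add_norm_sq_rpow {V : Type*} [NormedAddCommGroup V] {α : ℝ} (hα : 0 ≤ α) (x : V) :
    ‖x‖ ^ α ≤ (1 + ‖x‖ ^ 2) ^ (α / 2) := by
  calc ‖x‖ ^ α = (‖x‖ ^ 2) ^ (α / 2) := by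
        rw [← Real.rpow_natCast_mul (norm_nonneg x)]
        congr 1
        push_cast
        ring
    _ ≤ _ := by
        gcongr
        linarith

/-- The product `|F| |ζ|^α` is at most `|F|(1 + |ζ|²)^{s/2}` times `(1 + |ζ|²)^{(α-s)/2}`, and both
factors are square integrable. The strict inequality for the Sobolev exponent leaves room for some
`α > 0`. -/
theorem integrable_norm_mul_rpow {F : V → ℂ} (hF : AEStronglyMeasurable F volume) {s α : ℝ}
    (hα : 0 ≤ α) (hαs : (Module.finrank ℝ V : ℝ) < 2 * (s - α))
    (hFs : Integrable (fun ζ => ‖F ζ‖ ^ 2 * (1 + ‖ζ‖ ^ 2) ^ s)) :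
    Integrable (fun ζ => ‖F ζ‖ * ‖ζ‖ ^ α) := by
  have h1 : Integrable (fun ζ : V => (1 + ‖ζ‖ ^ 2) ^ (-(2 * (s - α)) / 2)) :=
    integrable_rpow_neg_one_add_norm_sq hαs
  refine (hFs.add h1).mono' (hF.norm.mul (Continuous.aestronglyMeasurable ?_))
    (.of_forall fun ζ => ?_)
  · exact continuous_norm.rpow_const fun _ => Or.inr hα
  rw [Real.norm_of_nonneg (by positivity), Pi.add_apply]
  have hp : (0 : ℝ) < 1 + ‖ζ‖ ^ 2 := by positivity
  have e1 : (1 + ‖ζ‖ ^ 2) ^ s = ((1 + ‖ζ‖ ^ 2) ^ (s / 2)) ^ 2 := by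
    rw [← Real.rpow_mul_natCast hp.le]; congr 1; push_cast; ring
  have e2 : (1 + ‖ζ‖ ^ 2) ^ (-(2 * (s - α)) / 2) = ((1 + ‖ζ‖ ^ 2) ^ ((α - s) / 2)) ^ 2 := by
    rw [← Real.rpow_mul_natCast hp.le]; congr 1; push_cast; ring
  have e3 : (1 + ‖ζ‖ ^ 2) ^ (α / 2) = (1 + ‖ζ‖ ^ 2) ^ (s / 2) * (1 + ‖ζ‖ ^ 2) ^ ((α - s) / 2) := by
    rw [← Real.rpow_add hp]; congr 1; ring
  have h2 := rpow_le_one_add_norm_sq_rpow hα ζ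
  rw [e3] at h2
  rw [e1, e2]
  have h3 := mul_le_mul_of_nonneg_left h2 (norm_nonneg (F ζ))
  nlinarith [sq_nonneg (‖F ζ‖ * (1 + ‖ζ‖ ^ 2) ^ (s / 2) - (1 + ‖ζ‖ ^ 2) ^ ((α - s) / 2)),
    sq_nonneg (‖F ζ‖ * (1 + ‖ζ‖ ^ 2) ^ (s / 2) + (1 + ‖ζ‖ ^ 2) ^ ((α - s) / 2))]

theorem exists_abs_besselKernel_sub_le {s α : ℝ} (hα : 0 < α) (hα1 : α ≤ 1)
    (hαs : (Module.finrank ℝ V : ℝ) < s - α) :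
    ∃ C, 0 ≤ C ∧ ∀ x y : V, |besselKernel s x - besselKernel s y| ≤ C * ‖x - y‖ ^ α := by
  have hs : (Module.finrank ℝ V : ℝ) < s := by linarith
  have hint : ∀ x : V, Integrable
      (fun ξ : V => (1 + ‖ξ‖ ^ 2) ^ (-s / 2) * Real.cos (2 * Real.pi * inner ℝ ξ x)) := fun x =>
    (integrable_one_add_norm_sq_rpow hs).mul_bdd (c := 1) (by fun_prop)
      (.of_forall fun ξ => Real.abs_cos_le_one _)
  have hI : Integrable (fun ξ : V => (1 + ‖ξ‖ ^ 2) ^ (-s / 2) * ‖ξ‖ ^ α) := by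
    refine (integrable_one_add_norm_sq_rpow hαs).mono' ?_ (.of_forall fun ξ => ?_)
    · exact ((continuous_one_add_norm_sq_rpow _).mul
        (continuous_norm.rpow_const fun _ => Or.inr hα.le)).aestronglyMeasurable
    · rw [Real.norm_of_nonneg (by positivity),
        show -(s - α) / 2 = -s / 2 + α / 2 by ring, Real.rpow_add (by positivity)]
      gcongr
      exact rpow_le_one_add_norm_sq_rpow hα.le ξ
  refine ⟨2 * (2 * Real.pi) ^ α * ∫ ξ : V, (1 + ‖ξ‖ ^ 2) ^ (-s / 2) * ‖ξ‖ ^ α,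
    mul_nonneg (by positivity) (integral_nonneg fun ξ => by positivity), fun x y => ?_⟩
  rw [besselKernel, besselKernel, ← integral_sub (hint x) (hint y), mul_right_comm,
    ← integral_const_mul, ← Real.norm_eq_abs]
  refine norm_integral_le_of_norm_le (hI.const_mul _) (.of_forall fun ξ => ?_)
  have h1 : |Real.cos (2 * Real.pi * inner ℝ ξ x) - Real.cos (2 * Real.pi * inner ℝ ξ y)| ≤
      max 2 1 * (2 * Real.pi * (‖ξ‖ * ‖x - y‖)) ^ α := by
    refine le_max_mul_rpow hα hα1 (by positivity) ?_ ?_ zero_le_two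
    · refine (abs_sub _ _).trans ?_
      have h2 := Real.abs_cos_le_one (2 * Real.pi * inner ℝ ξ x)
      have h3 := Real.abs_cos_le_one (2 * Real.pi * inner ℝ ξ y)
      linarith
    · refine (Real.abs_cos_sub_cos_le _ _).trans ?_
      rw [one_mul, ← mul_sub, ← inner_sub_right, abs_mul, abs_of_pos Real.two_pi_pos]
      gcongr
      exact abs_real_inner_le_norm _ _
  rw [max_eq_left one_le_two, Real.mul_rpow Real.two_pi_pos.le (by positivity),
    Real.mul_rpow (norm_nonneg ξ) (norm_nonneg (x - y))] at h1
  rw [← mul_sub, norm_mul, Real.norm_of_nonneg (by positivity), Real.norm_eq_abs]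
  calc _ ≤ (1 + ‖ξ‖ ^ 2) ^ (-s / 2) * (2 * ((2 * Real.pi) ^ α * (‖ξ‖ ^ α * ‖x - y‖ ^ α))) := by
        gcongr
    _ = _ := by ring

end Holder

/-! ### Regularity of the finitely many octaves of scales. -/

section TruncatedStar

variable {V : Type*} [NormedAddCommGroup V] [NormedSpace ℝ V]

theorem abs_truncStar_le {k : V → ℝ} {B : ℝ} (hB : ∀ x, |k x| ≤ B) {T : ℝ} (hT : 0 ≤ T) (x : V) :
    |truncStar k T x| ≤ B * T := by
  have := norm_setIntegral_le_of_norm_le_const (μ := volume) (s := Ioc 0 T)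
    (f := fun t => k (Real.exp t • x)) (C := B) (by simp) (fun t _ => hB _)
  simpa [truncStar, hT] using this

/-- Dilation by `eᵗ` multiplies the Lipschitz constant of `k` by at most `e^T` on the finite range
of scales; together with boundedness this interpolates to any exponent `α ≤ 1`. -/
theorem exists_abs_truncStar_sub_le {k : V → ℝ} (hk : Continuous k) {B : ℝ} (hB : ∀ x, |k x| ≤ B)
    {C : NNReal} (hC : LipschitzWith C k) {T : ℝ} (hT : 0 ≤ T) {α : ℝ} (hα : 0 < α) (hα1 : α ≤ 1) :
    ∃ C', 0 ≤ C' ∧ ∀ x y : V, |truncStar k T x - truncStar k T y| ≤ C' * ‖x - y‖ ^ α := by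
  have hB0 : 0 ≤ B := (abs_nonneg _).trans (hB 0)
  refine ⟨max (B * T + B * T) (C * Real.exp T * T),
    le_max_of_le_left (by positivity), fun x y => ?_⟩
  refine le_max_mul_rpow hα hα1 (norm_nonneg _) ?_ ?_ (by positivity)
  · exact (abs_sub _ _).trans (add_le_add (abs_truncStar_le hB hT x) (abs_truncStar_le hB hT y))
  · have hi : ∀ x : V, IntegrableOn (fun t : ℝ => k (Real.exp t • x)) (Ioc 0 T) := fun x =>
      (Continuous.integrableOn_Icc (by fun_prop)).mono_set Ioc_subset_Icc_self
    rw [truncStar, truncStar, ← integral_sub (hi x) (hi y)]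
    have := norm_setIntegral_le_of_norm_le_const (μ := volume) (s := Ioc 0 T)
      (f := fun t => k (Real.exp t • x) - k (Real.exp t • y)) (C := C * Real.exp T * ‖x - y‖)
      (by simp) (fun t ht => by
        have h1 := hC.dist_le_mul (Real.exp t • x) (Real.exp t • y)
        rw [dist_eq_norm, dist_eq_norm, ← smul_sub, norm_smul,
          Real.norm_of_nonneg (Real.exp_pos t).le, ← mul_assoc] at h1
        refine h1.trans ?_
        have := Real.exp_le_exp.mpr ht.2
        gcongr)
    simp only [Real.volume_real_Ioc_of_le hT, sub_zero] at this
    rw [← Real.norm_eq_abs]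
    refine this.trans_eq ?_
    ring

end TruncatedStar

end StarScale

namespace StarScale

open FourierTransform Set Filter Topology
open scoped ContDiff

theorem exists_contDiff_eq_one_on_compact {V : Type*} [NormedAddCommGroup V]
    [InnerProductSpace ℝ V] [FiniteDimensional ℝ V] {K D : Set V} (hK : IsCompact K) (hD : IsOpen D)
    (hKD : K ⊆ D) : ∃ χ : V → ℝ, ContDiff ℝ ∞ χ ∧ HasCompactSupport χ ∧ tsupport χ ⊆ D ∧
      ∀ x ∈ K, χ x = 1 := by
  obtain ⟨L, hL, hKL, hLD⟩ := exists_compact_between hK hD hKD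
  obtain ⟨χ, h1, h0, -⟩ := exists_contMDiffMap_one_nhds_of_subset_interior
    (modelWithCornersSelf ℝ V) (n := ⊤) hK.isClosed hKL
  have hsub : tsupport (χ : V → ℝ) ⊆ L := closure_minimal (fun x hx => by
    by_contra hcon
    exact hx (h0 x hcon)) hL.isClosed
  exact ⟨χ, χ.contMDiff.contDiff, hL.of_isClosed_subset (isClosed_tsupport _) hsub,
    hsub.trans hLD, fun x hx => h1.self_of_nhdsSet x hx⟩

/-! ### Regularity of kernels on the product space. -/

section SpectralKernels

variable {V : Type*} [NormedAddCommGroup V] [InnerProductSpace ℝ V] [FiniteDimensional ℝ V]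
  [MeasurableSpace V] [BorelSpace V]

theorem continuous_fourierInv {F : V → ℂ} (hF : Integrable F) : Continuous (𝓕⁻ F) := by
  rw [Real.fourierInv_eq_fourier_comp_neg]
  exact VectorFourier.fourierIntegral_continuous Real.continuous_fourierChar
    (by simpa using continuous_inner) hF.comp_neg

theorem continuous_of_fourierInv_eq {F : WithLp 2 (V × V) → ℂ} (hF : Integrable F) {M : V → V → ℝ}
    (hM : 𝓕⁻ F = fun z => ((M z.fst z.snd : ℝ) : ℂ)) :
    Continuous (fun p : V × V => M p.1 p.2) := by
  have h := Complex.continuous_re.comp ((continuous_fourierInv hF).comp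
    (WithLp.prod_continuous_toLp 2 V V))
  rw [hM] at h
  exact h

theorem abs_le_of_fourierInv_eq {F : WithLp 2 (V × V) → ℂ} {M : V → V → ℝ}
    (hM : 𝓕⁻ F = fun z => ((M z.fst z.snd : ℝ) : ℂ)) (x y : V) : |M x y| ≤ ∫ ζ, ‖F ζ‖ := by
  have h := congrFun hM (WithLp.toLp 2 (x, y))
  have h1 : ‖𝓕⁻ F (WithLp.toLp 2 (x, y))‖ ≤ ∫ ζ, ‖F ζ‖ := by
    rw [Real.fourierInv_eq_fourier_neg]
    exact VectorFourier.norm_fourierIntegral_le_integral_norm _ _ _ _ _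
  rw [h, Complex.norm_real] at h1
  exact h1

/-- Reconciles the Euclidean norm of the spectral side with the sup metric on `V × V` in which
Hölder continuity is stated. -/
theorem norm_toLp_sub_toLp_le {V : Type*} [NormedAddCommGroup V]
    (p q : V × V) :
    ‖WithLp.toLp 2 p - WithLp.toLp 2 q‖ ≤ 2 * dist p q := by
  have h1 : ‖p.1 - q.1‖ ≤ dist p q := by
    rw [← dist_eq_norm]; exact le_max_left _ _
  have h2 : ‖p.2 - q.2‖ ≤ dist p q := by
    rw [← dist_eq_norm]; exact le_max_right _ _
  have h3 : ‖WithLp.toLp 2 p - WithLp.toLp 2 q‖ ^ 2 = ‖p.1 - q.1‖ ^ 2 + ‖p.2 - q.2‖ ^ 2 :=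
    WithLp.prod_norm_sq_eq_of_L2 _
  have h4 : ‖p.1 - q.1‖ ^ 2 ≤ dist p q ^ 2 := by gcongr
  have h5 : ‖p.2 - q.2‖ ^ 2 ≤ dist p q ^ 2 := by gcongr
  refine le_of_sq_le_sq ?_ (by positivity)
  nlinarith [sq_nonneg (dist p q)]

theorem exists_abs_sub_le_of_fourierInv_eq {F : WithLp 2 (V × V) → ℂ} (hF : Integrable F)
    {M : V → V → ℝ} (hM : 𝓕⁻ F = fun z => ((M z.fst z.snd : ℝ) : ℂ)) {s α : ℝ} (hα : 0 < α)
    (hα1 : α ≤ 1) (hαs : (Module.finrank ℝ V : ℝ) < s - α)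
    (hFs : Integrable (fun ζ => ‖F ζ‖ ^ 2 * (1 + ‖ζ‖ ^ 2) ^ s)) :
    ∃ C, 0 ≤ C ∧ ∀ p q : V × V, |M p.1 p.2 - M q.1 q.2| ≤ C * dist p q ^ α := by
  have hfin : (Module.finrank ℝ (WithLp 2 (V × V)) : ℝ) < 2 * (s - α) := by
    rw [(WithLp.linearEquiv 2 ℝ (V × V)).finrank_eq, Module.finrank_prod]
    push_cast
    linarith
  have hFα := integrable_norm_mul_rpow hF.aestronglyMeasurable hα.le hfin hFs
  set C := 2 * (2 * Real.pi) ^ α * ∫ ζ, ‖F ζ‖ * ‖ζ‖ ^ α with hC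
  have hC0 : 0 ≤ C := mul_nonneg (by positivity) (integral_nonneg fun ζ => by positivity)
  refine ⟨C * 2 ^ α, by positivity, fun p q => ?_⟩
  have h1 := norm_fourierInv_sub_le hF hα hα1 hFα (WithLp.toLp 2 p) (WithLp.toLp 2 q)
  rw [hM, ← Complex.ofReal_sub, Complex.norm_real] at h1
  calc |M p.1 p.2 - M q.1 q.2| ≤ C * ‖WithLp.toLp 2 p - WithLp.toLp 2 q‖ ^ α := h1
    _ ≤ C * (2 * dist p q) ^ α := by
        gcongr
        exact norm_toLp_sub_toLp_le p q
    _ = _ := by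
        rw [Real.mul_rpow zero_le_two dist_nonneg]
        ring

theorem norm_sub_sub_sub_le {V : Type*} [NormedAddCommGroup V]
    (p q : V × V) : ‖(p.1 - p.2) - (q.1 - q.2)‖ ≤ 2 * dist p q := by
  have h1 : ‖p.1 - q.1‖ ≤ dist p q := by
    rw [← dist_eq_norm]; exact le_max_left _ _
  have h2 : ‖p.2 - q.2‖ ≤ dist p q := by
    rw [← dist_eq_norm]; exact le_max_right _ _
  rw [sub_sub_sub_comm]
  refine (norm_sub_le _ _).trans ?_
  linarith

theorem abs_stationary_sub_le {V : Type*} [NormedAddCommGroup V] {g : V → ℝ} {C α : ℝ}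
    (hα : 0 ≤ α) (hC : 0 ≤ C) (hg : ∀ x y, |g x - g y| ≤ C * ‖x - y‖ ^ α) (p q : V × V) :
    |g (p.1 - p.2) - g (q.1 - q.2)| ≤ C * 2 ^ α * dist p q ^ α := by
  refine (hg _ _).trans ?_
  rw [mul_assoc, ← Real.mul_rpow zero_le_two dist_nonneg]
  gcongr
  exact norm_sub_sub_sub_le p q

theorem continuous_truncStar {V : Type*} [NormedAddCommGroup V] [InnerProductSpace ℝ V]
    {k : V → ℝ} (hk : Continuous k) {B : ℝ} (hB : ∀ x, |k x| ≤ B)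
    {C : NNReal} (hC : LipschitzWith C k) {T : ℝ} (hT : 0 ≤ T) : Continuous (truncStar k T) := by
  obtain ⟨C', hC', h⟩ := exists_abs_truncStar_sub_le hk hB hC hT one_pos le_rfl
  refine LipschitzWith.continuous (K := ⟨C', hC'⟩) (LipschitzWith.of_dist_le_mul fun x y => ?_)
  have hxy := h x y
  rw [Real.rpow_one] at hxy
  rw [Real.dist_eq, dist_eq_norm]
  exact hxy

end SpectralKernels

/-! ### Positive definite kernels, dilated seeds and localization. -/

theorem setIntegral_form_eq {d : ℕ} {D : Set (Euc d)} {f : Euc d → ℝ} (hf : tsupport f ⊆ D)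
    (M : Euc d → Euc d → ℝ) :
    ∫ p in D ×ˢ D, M p.1 p.2 * f p.1 * f p.2 = ∫ p : Euc d × Euc d, M p.1 p.2 * f p.1 * f p.2 := by
  refine setIntegral_eq_integral_of_forall_compl_eq_zero fun p hp => ?_
  have h : ∀ x, x ∉ D → f x = 0 := fun x hx => image_eq_zero_of_notMem_tsupport fun h => hx (hf h)
  by_cases h1 : p.1 ∈ D
  · by_cases h2 : p.2 ∈ D
    · exact absurd ⟨h1, h2⟩ hp
    · simp [h _ h2]
  · simp [h _ h1]

theorem isPosDefKernel_of_form_nonneg {d : ℕ} {D : Set (Euc d)} {M : Euc d → Euc d → ℝ}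
    (hsymm : ∀ x ∈ D, ∀ y ∈ D, M x y = M y x) (hM : Continuous (fun p : Euc d × Euc d => M p.1 p.2))
    {B : ℝ} (hB : ∀ x y, |M x y| ≤ B)
    (hpos : ∀ f : Euc d → ℝ, Continuous f → HasCompactSupport f → tsupport f ⊆ D →
      0 ≤ ∫ p : Euc d × Euc d, M p.1 p.2 * f p.1 * f p.2) : IsPosDefKernel D M := by
  refine ⟨hsymm, fun f hf hfc hfD => ⟨?_, ?_⟩⟩
  · exact (integrable_form_of_bounded hM hB (hf.integrable_of_hasCompactSupport hfc)).integrableOn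
  · rw [setIntegral_form_eq hfD M]
    exact hpos f hf hfc hfD

/-- Since `e^T ≥ 1`, dilation shrinks the support and so keeps it in the unit interval. Positivity
survives because the dilated kernel has the same nonnegative density tested against `f̂(e^T ξ)`. -/
theorem isSeed_comp_exp_mul {d : ℕ} {k a : Euc d → ℝ} {κ : ℝ → ℝ} (hk : Continuous k) {B : ℝ}
    (hkB : ∀ x, |k x| ≤ B) {C : NNReal} (hκC : LipschitzWith C κ) (hkκ : ∀ x, k x = κ ‖x‖)
    (hκ0 : ∀ r, 0 ≤ κ r) (hκ1 : κ 0 = 1) (hκz : ∀ r, 1 ≤ r → κ r = 0) (ha : Integrable a)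
    (ha0 : ∀ ξ, 0 ≤ a ξ) (hka : ∀ x, k x = ∫ ξ, a ξ * Real.cos (2 * Real.pi * inner ℝ ξ x))
    {T : ℝ} (hT : 0 ≤ T) : IsSeed d (fun r => κ (Real.exp T * r)) := by
  have hkT : ∀ x y : Euc d, κ (Real.exp T * ‖x - y‖) = k (Real.exp T • (x - y)) := fun x y => by
    rw [hkκ, norm_smul, Real.norm_of_nonneg (Real.exp_pos T).le]
  refine ⟨?_, fun r _ => hκ0 _, by simpa using hκ1, fun r hr => hκz _ ?_, ?_⟩
  · refine ⟨C * ‖Real.exp T‖₊, (LipschitzWith.lipschitzOnWith ?_)⟩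
    exact hκC.comp (lipschitzWith_smul (Real.exp T))
  · exact one_le_mul_of_one_le_of_one_le (Real.one_le_exp hT) hr
  · simp only [hkT]
    refine isPosDefKernel_of_form_nonneg (fun x _ y _ => ?_) (by fun_prop) (fun x y => hkB _) ?_
    · rw [← hkT, ← hkT, norm_sub_rev]
    · intro f hf hfc _
      simp only [hka]
      rw [integral_spectral_form ha (hf.integrable_of_hasCompactSupport hfc)]
      exact integral_nonneg fun ξ => mul_nonneg (ha0 ξ) (by positivity)

/-- The localization of the regular part of a log-correlated kernel has a spectral density in a
weighted `L²` space. -/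
theorem exists_spectral_localization {d : ℕ} {s : ℝ} (hs : (d : ℝ) < s) {D : Set (Euc d)}
    (hD : IsOpen D) {L : Euc d → Euc d → ℝ}
    (hL : ContinuousOn (fun p : Euc d × Euc d => L p.1 p.2) (D ×ˢ D))
    (hLs : MemSobolevLoc s {z : Euc₂ d | z.fst ∈ D ∧ z.snd ∈ D} (fun z => L z.fst z.snd))
    {H : Euc d → ℝ} (hH : ContDiff ℝ ∞ H) {χ : Euc d → ℝ} (hχ : ContDiff ℝ ∞ χ)
    (hχc : HasCompactSupport χ) (hχD : tsupport χ ⊆ D) :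
    ∃ F : Euc₂ d → ℂ, AEStronglyMeasurable F volume ∧
      Integrable (fun ζ => ‖F ζ‖ ^ 2 * (1 + ‖ζ‖ ^ 2) ^ s) ∧ Integrable F ∧
      𝓕⁻ F = fun z => ((χ z.fst * χ z.snd * (L z.fst z.snd - H (z.fst - z.snd)) : ℝ) : ℂ) := by
  have hfst : ContDiff ℝ ∞ (fun z : Euc₂ d => z.fst) :=
    (WithLp.fstL 2 ℝ (Euc d) (Euc d)).contDiff
  have hsnd : ContDiff ℝ ∞ (fun z : Euc₂ d => z.snd) :=
    (WithLp.sndL 2 ℝ (Euc d) (Euc d)).contDiff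
  set ρ : Euc₂ d → ℝ := fun z => χ z.fst * χ z.snd with hρ
  have hρs : ContDiff ℝ ∞ ρ := (hχ.comp hfst).mul (hχ.comp hsnd)
  have hK : IsCompact ((WithLp.toLp 2) '' (tsupport χ ×ˢ tsupport χ) : Set (Euc₂ d)) :=
    (hχc.isCompact.prod hχc.isCompact).image (WithLp.prod_continuous_toLp 2 _ _)
  have hsub : tsupport ρ ⊆ (WithLp.toLp 2) '' (tsupport χ ×ˢ tsupport χ) := by
    refine closure_minimal (fun z hz => ?_) hK.isClosed
    have h := mul_ne_zero_iff.mp hz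
    exact ⟨(z.fst, z.snd), ⟨subset_tsupport χ h.1, subset_tsupport χ h.2⟩, rfl⟩
  have hρc : HasCompactSupport ρ := hK.of_isClosed_subset (isClosed_tsupport _) hsub
  have hρD : tsupport ρ ⊆ {z : Euc₂ d | z.fst ∈ D ∧ z.snd ∈ D} := by
    intro z hz
    obtain ⟨p, hp, rfl⟩ := hsub hz
    exact ⟨hχD hp.1, hχD hp.2⟩
  have hDo : IsOpen {z : Euc₂ d | z.fst ∈ D ∧ z.snd ∈ D} :=
    (hD.preimage hfst.continuous).inter (hD.preimage hsnd.continuous)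
  have h1 := hLs ρ hρs hρc hρD
  have h2 : MemSobolevSpace s (fun z : Euc₂ d => ((ρ z * -H (z.fst - z.snd) : ℝ) : ℂ)) := by
    refine memSobolevSpace_of_contDiff s ?_ ?_
    · exact Complex.ofRealCLM.contDiff.comp (hρs.mul (hH.comp (hfst.sub hsnd)).neg)
    · exact HasCompactSupport.comp_left (g := Complex.ofReal) hρc.mul_right Complex.ofReal_zero
  have h3 : MemSobolevSpace s (fun z : Euc₂ d =>
      ((χ z.fst * χ z.snd * (L z.fst z.snd - H (z.fst - z.snd)) : ℝ) : ℂ)) := by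
    convert h1.add h2 using 2 with z
    rw [hρ, ← Complex.ofReal_add, ← mul_add, sub_eq_add_neg]
  have hc : Continuous (fun z : Euc₂ d =>
      ((χ z.fst * χ z.snd * (L z.fst z.snd - H (z.fst - z.snd)) : ℝ) : ℂ)) := by
    refine Complex.continuous_ofReal.comp ?_
    refine ContinuousOn.continuous_of_tsupport_subset (s := {z | z.fst ∈ D ∧ z.snd ∈ D}) ?_ hDo ?_
    · refine hρs.continuous.continuousOn.mul (ContinuousOn.sub ?_ ?_)
      · exact hL.comp (hfst.continuous.prodMk hsnd.continuous).continuousOn fun z hz => hz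
      · exact (hH.continuous.comp (hfst.continuous.sub hsnd.continuous)).continuousOn
    · exact (tsupport_mul_subset_left (f := ρ)).trans hρD
  refine h3.exists_eq_fourierInv ?_ hc
  rw [(WithLp.linearEquiv 2 ℝ (Euc d × Euc d)).finrank_eq, Module.finrank_prod,
    finrank_euclideanSpace_fin]
  push_cast
  linarith

end StarScale

/-! ### Assembly. -/

open StarScale FourierTransform in
theorem mainTheorem8 {d : ℕ} (hd : 1 ≤ d) {s : ℝ} (hs : (d : ℝ) < s)
    (D : Set (EuclideanSpace ℝ (Fin d))) (hD : IsOpen D)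
    (K L : EuclideanSpace ℝ (Fin d) → EuclideanSpace ℝ (Fin d) → ℝ)
    (hK : StarScale.IsPosDefKernel D K)
    (hL : ContinuousOn (fun p : EuclideanSpace ℝ (Fin d) × EuclideanSpace ℝ (Fin d) => L p.1 p.2)
      (D ×ˢ D))
    (hKL : ∀ x ∈ D, ∀ y ∈ D, x ≠ y → K x y = L x y + Real.log (1 / ‖x - y‖))
    (hLs : StarScale.MemSobolevLoc s {z : StarScale.Euc₂ d | z.fst ∈ D ∧ z.snd ∈ D}
      (fun z => L z.fst z.snd))
    (D' : Set (EuclideanSpace ℝ (Fin d))) (hD' : IsOpen D') (hD'b : Bornology.IsBounded D')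
    (hD'D : closure D' ⊆ D) (δ : ℝ) (hδ : 0 < δ) :
    ∃ Kδ Δ : EuclideanSpace ℝ (Fin d) → EuclideanSpace ℝ (Fin d) → ℝ,
      StarScale.HasStarScaleInvariantPart D' Kδ ∧
      ContinuousOn (fun p : EuclideanSpace ℝ (Fin d) × EuclideanSpace ℝ (Fin d) => Δ p.1 p.2)
        (D' ×ˢ D') ∧
      (∀ x ∈ D', ∀ y ∈ D', x ≠ y → Kδ x y - K x y = Δ x y) ∧
      (∀ x ∈ D', ∀ y ∈ D', |Δ x y| ≤ δ) ∧
      StarScale.IsPosDefKernel D' Δ := by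
  have : Nonempty (Fin d) := ⟨⟨0, hd⟩⟩
  have hfr : (Module.finrank ℝ (Euc d) : ℝ) = d := by rw [finrank_euclideanSpace_fin]
  have hs' : (Module.finrank ℝ (Euc d) : ℝ) < s := by rwa [hfr]
  obtain ⟨k, κ, a, hk, hkc, hκ, ⟨Cκ, hκC⟩, hkκ, hκ0, hκ1, hκz, ha, ha0, hka⟩ :=
    exists_seedKernel (Euc d)
  obtain ⟨H, hH, hHlog⟩ := exists_contDiff_starScale_eq_log hk hκ hkκ hκ1 hκz
  have hkz : ∀ x : Euc d, 1 ≤ ‖x‖ → k x = 0 := fun x hx => by rw [hkκ, hκz _ hx]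
  have hkneg : ∀ x : Euc d, k (-x) = k x := fun x => by rw [hkκ, hkκ, norm_neg]
  have htail : ∀ (T : ℝ) (x : Euc d), tailStar k T x =
      ∫ t in Set.Ioi (0 : ℝ), κ (Real.exp T * (Real.exp t * ‖x‖)) := fun T x => by
    rw [tailStar_eq_comp_smul, tailStar]
    simp only [hkκ, norm_smul, Real.norm_of_nonneg (Real.exp_pos _).le]
    congr 1 with t
    ring_nf
  have hlog : ∀ x : Euc d, x ≠ 0 → tailStar k 0 x = Real.log (1 / ‖x‖) + H x := fun x hx => by
    rw [htail, ← hHlog x hx]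
    simp
  -- Evenness of `H` is read off the defining identity away from `0`, where the other two terms are
  -- radial.
  have hHneg : ∀ x : Euc d, H (-x) = H x := fun x => by
    rcases eq_or_ne x 0 with rfl | hx
    · simp
    · have h1 := hlog x hx
      have h2 := hlog (-x) (neg_ne_zero.mpr hx)
      rw [htail, norm_neg, ← htail] at h2
      linarith
  obtain ⟨Bk, hBk⟩ : ∃ B, ∀ x, |k x| ≤ B := hkc.exists_bound_of_continuous hk.continuous
  obtain ⟨Ck, hCk⟩ := ContDiff.lipschitzWith_of_hasCompactSupport hkc hk (by simp)
  have hD'c : IsCompact (closure D') := hD'b.isCompact_closure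
  obtain ⟨η₀, hη₀, hη₀D⟩ := hD'c.exists_cthickening_subset_open hD hD'D
  obtain ⟨η₁, hη₁, hη₁c⟩ := hD'c.exists_isCompact_cthickening
  -- One radius keeps the thickening of `D'` inside `D`, the other keeps it compact.
  set η := min η₀ η₁ with hηdef
  have hη : 0 < η := lt_min hη₀ hη₁
  rw [Metric.cthickening_closure] at hη₀D hη₁c
  have hND : Metric.cthickening η D' ⊆ D :=
    (Metric.cthickening_mono (min_le_left _ _) _).trans hη₀D
  have hNc : IsCompact (Metric.cthickening η D') := hη₁c.of_isClosed_subset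
    Metric.isClosed_cthickening (Metric.cthickening_mono (min_le_right _ _) _)
  have hD'N : D' ⊆ Metric.cthickening η D' := Metric.self_subset_cthickening D'
  -- The cut-off must be `1` on the whole thickening, since mollified test functions live there.
  obtain ⟨χ, hχ, hχc, hχD, hχ1⟩ := exists_contDiff_eq_one_on_compact hNc hD hND
  set M : Euc d → Euc d → ℝ := fun x y => χ x * χ y * (L x y - H (x - y)) with hMdef
  have hMN : ∀ x ∈ Metric.cthickening η D', ∀ y ∈ Metric.cthickening η D',
      M x y = L x y - H (x - y) := fun x hx y hy => by simp [hMdef, hχ1 x hx, hχ1 y hy]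
  obtain ⟨F, hFm, hFs, hF, hFM⟩ := exists_spectral_localization hs hD hL hLs hH hχ hχc hχD
  change 𝓕⁻ F = fun z => ((M z.fst z.snd : ℝ) : ℂ) at hFM
  obtain ⟨α, hα, hα1, hαs⟩ : ∃ α : ℝ, 0 < α ∧ α ≤ 1 ∧ (d : ℝ) < s - α :=
    ⟨min 1 ((s - d) / 2), by
      have : 0 < (s - d) / 2 := by linarith
      positivity, min_le_left _ _, by
      have := min_le_right 1 ((s - d) / 2)
      linarith⟩
  have hαs' : (Module.finrank ℝ (Euc d) : ℝ) < s - α := by rwa [hfr]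
  have hMc := continuous_of_fourierInv_eq hF hFM
  have hMb := abs_le_of_fourierInv_eq hFM
  have hK0 : ∀ x ∈ Metric.cthickening η D', ∀ y ∈ Metric.cthickening η D', x ≠ y →
      M x y + tailStar k 0 (x - y) = K x y := fun x hx y hy hxy => by
    rw [hMN x hx y hy, hKL x (hND hx) y (hND hy) hxy, hlog _ (sub_ne_zero.mpr hxy)]
    ring
  have hpos : ∀ u : Euc d → ℝ, Continuous u → HasCompactSupport u →
      tsupport u ⊆ Metric.cthickening η D' →
      0 ≤ ∫ p : Euc d × Euc d, (M p.1 p.2 + tailStar k 0 (p.1 - p.2)) * u p.1 * u p.2 := by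
    intro u hu huc huN
    have h1 := (hK.2 u hu huc (huN.trans hND)).2
    rw [setIntegral_form_eq (huN.trans hND) K] at h1
    refine h1.trans_eq (integral_congr_ae ?_)
    filter_upwards [ae_fst_ne_snd] with p hp
    have hu0 : ∀ x, x ∉ Metric.cthickening η D' → u x = 0 := fun x hx =>
      image_eq_zero_of_notMem_tsupport fun h => hx (huN h)
    by_cases h2 : p.1 ∈ Metric.cthickening η D'
    · by_cases h3 : p.2 ∈ Metric.cthickening η D'
      · rw [hK0 _ h2 _ h3 hp]
      · simp [hu0 _ h3]
    · simp [hu0 _ h2]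
  set W : ℝ := ∫ ξ : Euc d, (1 + ‖ξ‖ ^ 2) ^ (-s / 2) with hW
  -- `W` bounds the Bessel kernel, so `ε W ≤ δ`; the `+ 1` makes positivity of the denominator
  -- immediate.
  set ε : ℝ := δ / (W + 1) with hεdef
  have hε : 0 < ε := by positivity
  have hεW : ε * W ≤ δ := by
    rw [hεdef, div_mul_eq_mul_div, div_le_iff₀ (by positivity)]
    nlinarith
  obtain ⟨T, hT, hTpos⟩ := exists_nonneg_form_truncStar hs' hF hFs hFM hMc hMb hk.continuous hkc hkz
    ha ha0 hka hη subset_rfl hpos hε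
  have hRc : Continuous (besselKernel s : Euc d → ℝ) := continuous_besselKernel hs'
  have hRb : ∀ x : Euc d, |besselKernel s x| ≤ W := abs_besselKernel_le hs'
  have hSc : Continuous (truncStar k T) := continuous_truncStar hk.continuous hBk hCk hT
  have hSb : ∀ x, |truncStar k T x| ≤ Bk * T := abs_truncStar_le hBk hT
  have hSneg : ∀ x, truncStar k T (-x) = truncStar k T x := fun x => by
    simp only [truncStar, smul_neg, hkneg]
  have hK0c : Continuous (fun p : Euc d × Euc d =>
      M p.1 p.2 + truncStar k T (p.1 - p.2) + ε * besselKernel s (p.1 - p.2)) := by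
    fun_prop
  have hεR : ∀ x : Euc d, |ε * besselKernel s x| ≤ δ := fun x => by
    rw [abs_mul, abs_of_pos hε]
    exact (mul_le_mul_of_nonneg_left (hRb x) hε.le).trans hεW
  have hK0b : ∀ x y, |M x y + truncStar k T (x - y) + ε * besselKernel s (x - y)| ≤
      (∫ ζ, ‖F ζ‖) + Bk * T + δ := fun x y =>
    (abs_add_three _ _ _).trans (add_le_add (add_le_add (hMb x y) (hSb _)) (hεR _))
  have hLsymm : ∀ x ∈ D', ∀ y ∈ D', L x y = L y x := fun x hx y hy => by
    rcases eq_or_ne x y with rfl | hxy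
    · rfl
    · have hx' := hND (hD'N hx)
      have hy' := hND (hD'N hy)
      have h1 := hKL x hx' y hy' hxy
      have h2 := hKL y hy' x hx' hxy.symm
      rw [hK.1 x hx' y hy', norm_sub_rev x y] at h1
      linarith
  -- The scales up to `T` join the regular part `K₀`; those beyond `T` form the star-scale part,
  -- with seed `κ(e^T r)`.
  refine ⟨fun x y => K x y + ε * besselKernel s (x - y), fun x y => ε * besselKernel s (x - y),
    ⟨fun x y => M x y + truncStar k T (x - y) + ε * besselKernel s (x - y),
      fun r => κ (Real.exp T * r), ⟨_, fun x _ y _ => hK0b x y⟩, ?_, ?_,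
      isSeed_comp_exp_mul hk.continuous hBk hκC hkκ hκ0 hκ1 hκz ha ha0 hka hT, ?_⟩,
    ?_, fun x _ y _ _ => by ring, fun x _ y _ => hεR _, ?_⟩
  · obtain ⟨C₁, hC₁, h₁⟩ := exists_abs_sub_le_of_fourierInv_eq hF hFM hα hα1 hαs' hFs
    obtain ⟨C₂, hC₂, h₂⟩ := exists_abs_truncStar_sub_le hk.continuous hBk hCk hT hα hα1
    obtain ⟨C₃, hC₃, h₃⟩ := exists_abs_besselKernel_sub_le (V := Euc d) hα hα1 hαs'
    have hC : 0 ≤ C₁ + C₂ * 2 ^ α + ε * (C₃ * 2 ^ α) := by positivity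
    refine ⟨⟨_, hC⟩, ⟨α, hα.le⟩, hα, hα1, holderOnWith_of_dist_le (fun p q => ?_) _⟩
    have e₂ := abs_stationary_sub_le hα.le hC₂ h₂ p q
    have e₃ := abs_stationary_sub_le hα.le hC₃ h₃ p q
    have e₃' : |ε * besselKernel s (p.1 - p.2) - ε * besselKernel s (q.1 - q.2)| ≤
        ε * (C₃ * 2 ^ α * dist p q ^ α) := by
      rw [← mul_sub, abs_mul, abs_of_pos hε]
      gcongr
    change |_| ≤ (C₁ + C₂ * 2 ^ α + ε * (C₃ * 2 ^ α)) * dist p q ^ α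
    rw [add_sub_add_comm, add_sub_add_comm]
    refine (abs_add_three _ _ _).trans ((add_le_add (add_le_add (h₁ p q) e₂) e₃').trans_eq ?_)
    ring
  · refine isPosDefKernel_of_form_nonneg (fun x hx y hy => ?_) hK0c hK0b hTpos
    rw [hMN x (hD'N hx) y (hD'N hy), hMN y (hD'N hy) x (hD'N hx), hLsymm x hx y hy, ← neg_sub y x,
      hHneg, hSneg, besselKernel_neg]
  · intro x hx y hy hxy
    beta_reduce
    rw [← htail, ← hK0 x (hD'N hx) y (hD'N hy) hxy,
      tailStar_zero_eq hk.continuous hkz (sub_ne_zero.mpr hxy) hT]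
    ring
  · exact (continuous_const.mul (hRc.comp (continuous_fst.sub continuous_snd))).continuousOn
  · refine isPosDefKernel_of_form_nonneg (fun x _ y _ => ?_) (by fun_prop) (fun x y => hεR _)
      fun f hf hfc _ => ?_
    · rw [← neg_sub y x, besselKernel_neg]
    · have h : ∀ p : Euc d × Euc d, ε * besselKernel s (p.1 - p.2) * f p.1 * f p.2 =
          ε * (besselKernel s (p.1 - p.2) * f p.1 * f p.2) := fun p => by ring
      simp only [h]
      rw [integral_const_mul,
        integral_besselKernel_form hs' (hf.integrable_of_hasCompactSupport hfc)]
      exact mul_nonneg hε.le (integral_nonneg fun ξ => by positivity)
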